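/- **Setting.** Let $X\in\mathbb R^{N\times N}$ be symmetric positive definite with eigenvalues $\lambda_{X,n}$. Let $b,N_s\ge 1$, and let $\rho^m[s]\in\mathbb R^N$ ($1\le m\le b$, $1\le s\le N_s$) be given samples. Let $q_{\min},q_{\max},\nu_{\min},\nu_{\max}\in\mathbb R^N$, $\xi\neq 0$ and $\epsilon_1,\dots,\epsilon_4\in(0,1)$. For $x=(x_1,x_2)\in\mathbb R^2$ and $\rho\in\mathbb R^N$ put $$q(x;\rho)=[X+(x_1+x_2)I]^{-1}(\mathbb 1-\rho),\qquad h_0(x;\rho)=\|q(x;\rho)\|^2,$$ $$h_1=q-q_{\max},\quad h_2=-q+q_{\min},\quad h_3=Xq+\rho-\nu_{\max},\quad h_4=-Xq-\rho+\nu_{\min},$$ $$\phi(y)=\tfrac12\bigl(y+\sqrt{\xi^2+y^2}\bigr),\qquad g_{i,n}(x,u;\rho)=\phi\bigl(h_{i,n}(x;\rho)+u\bigr)-u\,\epsilon_i .$$ Let $\mathcal K=\{x:\ x_1+x_2-2+\lambda_{X,n}\le 0\ \forall n,\ x_1+x_2\ge 0,\ x_1\ge 0,\ x_2\le 0\}$.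 The problem is $$(\mathrm{P4})\quad \min_{x\in\mathcal K,\ u\ge 0}\ U(x)=\sum_{m=1}^b\frac1{N_s}\sum_{s=1}^{N_s}h_0(x;\rho^m[s])\quad\text{s.t.}\quad G_{i,n,m}(x,u)=\frac1{N_s}\sum_{s=1}^{N_s}g_{i,n}(x,u_{i,n}^m;\rho^m[s])\le 0$$ for all $i\le 4$, $n\le N$, $m\le b$. Let $\mathcal X$ be the set of all $x$ such that $(x,u)$ is feasible for some $u$. Let $\mathcal N(z)$ be the normal cone of $\mathcal K\times\{u\ge0\}$ at $z=(x,u)$. A feasible $z$ is *regular* if $0\in\sum_j\mu_j\nabla G_j(z)+\mathcal N(z)$, with $\mu_j\ge 0$ and $\mu_j=0$ whenever $G_j(z)\ne 0$, forces $\mu=0$ (Mangasarian–Fromovitz). A feasible $z$ is *stationary* if $0\in\nabla U(z)+\sum_j\mu_j\nabla G_j(z)+\mathcal N(z)$ for some $\mu_j\ge0$ with $\mu_j=0$ whenever $G_j(z)\neq0$. **Algorithm.** The Hessian of $h_{i,n}(\cdot;\rho)$ at $x$ is $c_{i,n}(x;\rho)\begin{pmatrix}1&1\\1&1\end{pmatrix}$,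 where $c_1=2[X+(x_1+x_2)I]^{-3}(\mathbb 1-\rho)$, $c_2=-c_1$, $c_3=Xc_1$, $c_4=-Xc_1$. Let $\bar c_{i,n}^{m,s}$ be any upper bound of $c_{i,n}(\cdot;\rho^m[s])$ on $\mathcal K$, let $M=2\max(0,\bar c_{i,n}^{m,s})I$, and let $d>0$. At $y\in\mathbb R^2$ define the surrogates $$\tilde h_0(x;\rho,y)=\|q(y;\rho)+\nabla q(y;\rho)^\top(x-y)\|^2+\tfrac d2\|x-y\|^2,$$ $$\tilde h_{i,n}(x;\rho,y)=h_{i,n}(y;\rho)+\nabla h_{i,n}(y;\rho)^\top(x-y)+(x-y)^\top M(x-y),\qquad \tilde g_{i,n}=\phi(\tilde h_{i,n}+u)-u\,\epsilon_i .$$ Let $(\mathrm{P5}(y))$ be (P4) with $h_0,g_{i,n}$ replaced by $\tilde h_0,\tilde g_{i,n}$, and let $x^*(y)$ be the $x$-component of a solution of it. The algorithm starts from $x_0\in\mathcal X$ and sets $x_{p+1}=x_p+\gamma_p\,(x^*(x_p)-x_p)$ for all $p\ge0$, without a stopping test. **Proposition.** Let $(x_p)$ be generated by the algorithm, and suppose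 that one of the following holds. 1. $0<\inf_p\gamma_p\le\sup_p\gamma_p\le\gamma^{\max}\le1$ and $2c\ge\gamma^{\max}L$ for some $c>0$ and $L\ge0$ such that, for every sample $\rho=\rho^m[s]$, $\tilde h_0(\cdot;\rho,y)$ is strongly convex on $\mathcal K$ with constant $c$ for every $y\in\mathcal X$, and $\nabla h_0(\cdot;\rho)$ is $L$-Lipschitz on $\mathcal K$. 2. $\gamma_p\in(0,1]$, $\gamma_p\to0$, $\sum_p\gamma_p=+\infty$, and for every $y\in\mathcal X$ the point $x^*(y)$ is regular (that is, $(x^*(y),u)$ is regular for some $u$). Let $\bar x$ be a limit point of $(x_p)$, and let $u$ be such that $(\bar x,u)$ is regular. Then: - $(\bar x,u)$ is a stationary solution of (P4); - if $x_{p+1}\ne x_p$ for all $p$ (the algorithm does not stop at a fixed point after finitely many steps), then $\bar x$ is not a local maximum of $U$ on $\mathcal X$; - if at least one sample $\rho^m[s]$ differs from $\mathbb 1$ (otherwise $U\equiv0$), then $\bar x$ is not a local maximum of $U$ as a function on $\mathbb R^2$. -/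

import Mathlib

open scoped Matrix Topology
open Filter

noncomputable section

namespace GainDesign

/-- The space of transformed controller gains `x = (α / η, -α)`, with its Euclidean norm. -/
abbrev Gains := EuclideanSpace ℝ (Fin 2)

/-- Indices `(i, n, m)` of the sample-averaged constraints: type `i` of constraint (upper and lower
limit of the reactive power, upper and lower limit of the voltage), node `n`, forecast interval `m`.
The auxiliary variables `u` carry the same indices. -/
abbrev Idx (N b : ℕ) := Fin 4 × Fin N × Fin b

/-- The space of all decision variables `(x, u)`. -/
abbrev Var (N b : ℕ) := Gains × (Idx N b → ℝ)

/-- Data of the sample-averaged gain-design problem on a network with `N` nodes, over `b` forecast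
intervals, with `Ns` samples in each interval. -/
structure Data (N b Ns : ℕ) where
  /-- linearized power-flow matrix -/
  X : Matrix (Fin N) (Fin N) ℝ
  X_posDef : X.PosDef
  /-- `ρ m s` is the `s`-th sample of the voltage profile in the `m`-th interval -/
  ρ : Fin b → Fin Ns → Fin N → ℝ
  qmin : Fin N → ℝ
  qmax : Fin N → ℝ
  νmin : Fin N → ℝ
  νmax : Fin N → ℝ
  /-- smoothing parameter -/
  ξ : ℝ
  ξ_ne_zero : ξ ≠ 0
  /-- violation probabilities -/
  ε : Fin 4 → ℝ
  ε_mem : ∀ i, ε i ∈ Set.Ioo (0 : ℝ) 1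

/-- The normal cone of `C` at `z`, as a set of linear functionals. -/
def normalCone {E : Type*} [NormedAddCommGroup E] [NormedSpace ℝ E] (C : Set E) (z : E) :
    Set (E →L[ℝ] ℝ) :=
  {ℓ | ∀ y ∈ C, ℓ (y - z) ≤ 0}

namespace Data

variable {N b Ns : ℕ} (D : Data N b Ns)

/-! ### The problem -/

/-- The equilibrium `q(x; ρ) = [X + (x₁ + x₂) I]⁻¹ (𝟙 - ρ)`. -/
def q (ρ : Fin N → ℝ) (x : Gains) : EuclideanSpace ℝ (Fin N) :=
  WithLp.toLp 2 ((D.X + (x 0 + x 1) • (1 : Matrix (Fin N) (Fin N) ℝ))⁻¹ *ᵥ (fun n => 1 - ρ n))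

/-- `h₀(x; ρ) = ‖q(x; ρ)‖²`. -/
def h0 (ρ : Fin N → ℝ) (x : Gains) : ℝ := ‖D.q ρ x‖ ^ 2

/-- The vector-valued functions `h₁, h₂, h₃, h₄`, here with `i = 0, 1, 2, 3`. -/
def h (i : Fin 4) (n : Fin N) (ρ : Fin N → ℝ) (x : Gains) : ℝ :=
  match i with
  | 0 => D.q ρ x n - D.qmax n
  | 1 => -D.q ρ x n + D.qmin n
  | 2 => (D.X *ᵥ (D.q ρ x).ofLp) n + ρ n - D.νmax n
  | 3 => -(D.X *ᵥ (D.q ρ x).ofLp) n - ρ n + D.νmin n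

/-- The smooth approximation `(y + √(ξ² + y²)) / 2` of `max y 0`. -/
def smoothPos (y : ℝ) : ℝ := (1 / 2) * (y + Real.sqrt (D.ξ ^ 2 + y ^ 2))

/-- The smoothed chance-constraint function `g_{i,n}(x, u; ρ)`. -/
def g (i : Fin 4) (n : Fin N) (ρ : Fin N → ℝ) (x : Gains) (u : ℝ) : ℝ :=
  D.smoothPos (D.h i n ρ x + u) - u * D.ε i

/-- The objective `∑ₘ (1/Nₛ) ∑ₛ h₀(x; ρᵐ[s])`. -/
def objective (x : Gains) : ℝ := ∑ m, (1 / (Ns : ℝ)) * ∑ s, D.h0 (D.ρ m s) x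

/-- The sample-averaged constraint function with index `j = (i, n, m)`. -/
def constr (j : Idx N b) (z : Var N b) : ℝ :=
  (1 / (Ns : ℝ)) * ∑ s, D.g j.1 j.2.1 (D.ρ j.2.2 s) z.1 (z.2 j)

/-- The set `𝒦` given by the convex constraints `h₅, h₆, h₇, h₈ ≤ 0`. -/
def K : Set Gains :=
  {x | (∀ n, x 0 + x 1 - 2 + D.X_posDef.isHermitian.eigenvalues n ≤ 0) ∧
    -(x 0 + x 1) ≤ 0 ∧ -x 0 ≤ 0 ∧ x 1 ≤ 0}

/-- The convex set `𝒦 × {u ≥ 0}` of decision variables. -/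
def base : Set (Var N b) := {z | z.1 ∈ D.K ∧ ∀ j, 0 ≤ z.2 j}

/-- The feasible set of the problem, in the variables `(x, u)`. -/
def feasible : Set (Var N b) := {z | z ∈ D.base ∧ ∀ j, D.constr j z ≤ 0}

/-- The set `𝒳` of feasible gains. -/
def feasibleGains : Set Gains := {x | ∃ u, (x, u) ∈ D.feasible}

/-- Regularity (Mangasarian-Fromovitz constraint qualification in dual form) of a feasible point:
`0 ∈ ∑ⱼ μⱼ ∇Gⱼ(z) + N(z)` with `μ ≥ 0` supported on the active constraints forces `μ = 0`, where `N`
is the normal cone of the convex set `𝒦 × {u ≥ 0}`. -/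
def IsRegular (z : Var N b) : Prop :=
  z ∈ D.feasible ∧
    ∀ μ : Idx N b → ℝ, (∀ j, 0 ≤ μ j) → (∀ j, D.constr j z ≠ 0 → μ j = 0) →
      -(∑ j, μ j • fderiv ℝ (D.constr j) z) ∈ normalCone D.base z → ∀ j, μ j = 0

/-- Stationarity (Karush-Kuhn-Tucker conditions) of a feasible point:
`0 ∈ ∇F(z) + ∑ⱼ μⱼ ∇Gⱼ(z) + N(z)` for some `μ ≥ 0` supported on the active constraints. -/
def IsStationary (z : Var N b) : Prop :=
  z ∈ D.feasible ∧
    ∃ μ : Idx N b → ℝ, (∀ j, 0 ≤ μ j) ∧ (∀ j, D.constr j z ≠ 0 → μ j = 0) ∧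
      -(fderiv ℝ (fun w : Var N b => D.objective w.1) z + ∑ j, μ j • fderiv ℝ (D.constr j) z) ∈
        normalCone D.base z

/-! ### The surrogates and the algorithm -/

/-- The scalar `c_{i,n}(x; ρ)` for which the Hessian of `h_{i,n}( · ; ρ)` at `x` is
`c_{i,n}(x; ρ) [[1, 1], [1, 1]]`: the entries of `c₁ = 2 [X + (x₁ + x₂) I]⁻³ (𝟙 - ρ)`, `c₂ = -c₁`,
`c₃ = X c₁`, `c₄ = -X c₁`. -/
def curvature (i : Fin 4) (n : Fin N) (ρ : Fin N → ℝ) (x : Gains) : ℝ :=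
  let c₁ : Fin N → ℝ :=
    (2 : ℝ) • (((D.X + (x 0 + x 1) • (1 : Matrix (Fin N) (Fin N) ℝ))⁻¹ ^ 3) *ᵥ fun n => 1 - ρ n)
  match i with
  | 0 => c₁ n
  | 1 => -c₁ n
  | 2 => (D.X *ᵥ c₁) n
  | 3 => -(D.X *ᵥ c₁) n

/-- `cbar m s i n` is an upper bound on `𝒦` of the curvature of `h_{i,n}( · ; ρᵐ[s])`. -/
def IsCurvatureBound (cbar : Fin b → Fin Ns → Fin 4 → Fin N → ℝ) : Prop :=
  ∀ m s i n, ∀ x ∈ D.K, D.curvature i n (D.ρ m s) x ≤ cbar m s i n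

/-- The matrix `M = 2 diag(max(0, c), max(0, c))` built from a curvature bound `c`. -/
def surrogateMatrix (c : ℝ) : Matrix (Fin 2) (Fin 2) ℝ :=
  (2 : ℝ) • Matrix.diagonal fun _ => max 0 c

/-- The surrogate `‖q(y) + ∇q(y)ᵀ (x - y)‖² + (d/2) ‖x - y‖²` of `h₀` at the point `y`. -/
def h0Sur (d : ℝ) (ρ : Fin N → ℝ) (y x : Gains) : ℝ :=
  ‖D.q ρ y + fderiv ℝ (D.q ρ) y (x - y)‖ ^ 2 + d / 2 * ‖x - y‖ ^ 2

/-- The surrogate `h(y) + ∇h(y)ᵀ (x - y) + (x - y)ᵀ M (x - y)` of `h = h_{i,n}` at the point `y`. -/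
def hSur (c : ℝ) (i : Fin 4) (n : Fin N) (ρ : Fin N → ℝ) (y x : Gains) : ℝ :=
  D.h i n ρ y + fderiv ℝ (D.h i n ρ) y (x - y) +
    (x - y).ofLp ⬝ᵥ (surrogateMatrix c *ᵥ (x - y).ofLp)

/-- The surrogate of `g_{i,n}` at the point `y`. -/
def gSur (c : ℝ) (i : Fin 4) (n : Fin N) (ρ : Fin N → ℝ) (y x : Gains) (u : ℝ) : ℝ :=
  D.smoothPos (D.hSur c i n ρ y x + u) - u * D.ε i

/-- The objective of the convex subproblem at `y`. -/
def objectiveSur (d : ℝ) (y x : Gains) : ℝ :=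
  ∑ m, (1 / (Ns : ℝ)) * ∑ s, D.h0Sur d (D.ρ m s) y x

/-- The constraint functions of the convex subproblem at `y`. -/
def constrSur (cbar : Fin b → Fin Ns → Fin 4 → Fin N → ℝ) (y : Gains) (j : Idx N b)
    (z : Var N b) : ℝ :=
  (1 / (Ns : ℝ)) *
    ∑ s, D.gSur (cbar j.2.2 s j.1 j.2.1) j.1 j.2.1 (D.ρ j.2.2 s) y z.1 (z.2 j)

/-- The feasible set of the convex subproblem at `y`. -/
def feasibleSur (cbar : Fin b → Fin Ns → Fin 4 → Fin N → ℝ) (y : Gains) : Set (Var N b) :=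
  {z | z ∈ D.base ∧ ∀ j, D.constrSur cbar y j z ≤ 0}

/-- `xs` is the `x`-component of a solution of the convex subproblem at `y`. -/
def IsSubSolution (d : ℝ) (cbar : Fin b → Fin Ns → Fin 4 → Fin N → ℝ) (y xs : Gains) : Prop :=
  ∃ us, (xs, us) ∈ D.feasibleSur cbar y ∧
    ∀ z ∈ D.feasibleSur cbar y, D.objectiveSur d y xs ≤ D.objectiveSur d y z.1

/-- `x` is a sequence of iterates of the successive convex approximation algorithm with step sizes
`γ` (run without the numerical stopping test). -/
def IsSCASequence (d : ℝ) (cbar : Fin b → Fin Ns → Fin 4 → Fin N → ℝ) (γ : ℕ → ℝ)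
    (x : ℕ → Gains) : Prop :=
  x 0 ∈ D.feasibleGains ∧
    ∀ p, ∃ xs, D.IsSubSolution d cbar (x p) xs ∧ x (p + 1) = x p + γ p • (xs - x p)

/-- First step-size rule: `0 < inf γ ≤ sup γ ≤ γmax ≤ 1` and `2 c ≥ γmax L`, where the surrogates of
`h₀` are strongly convex on `𝒦` with constant `c` and the gradients of `h₀` are Lipschitz on `𝒦` with
constant `L`, uniformly in the samples. -/
def StepRuleBounded (d : ℝ) (γ : ℕ → ℝ) : Prop :=
  ∃ (γmin γmax c : ℝ) (L : NNReal), 0 < γmin ∧ (∀ p, γmin ≤ γ p ∧ γ p ≤ γmax) ∧ γmax ≤ 1 ∧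
    0 < c ∧ (∀ m s, ∀ y ∈ D.feasibleGains, StrongConvexOn D.K c (D.h0Sur d (D.ρ m s) y)) ∧
    (∀ m s, LipschitzOnWith L (gradient (D.h0 (D.ρ m s))) D.K) ∧
    γmax * L ≤ 2 * c

/-- Second step-size rule: `γ p ∈ (0, 1]`, `γ p → 0`, `∑ γ p = ∞`, and the solutions of all
subproblems at feasible points are regular points of the problem. -/
def StepRuleDiminishing (d : ℝ) (cbar : Fin b → Fin Ns → Fin 4 → Fin N → ℝ) (γ : ℕ → ℝ) : Prop :=
  (∀ p, 0 < γ p ∧ γ p ≤ 1) ∧ Tendsto γ atTop (𝓝 0) ∧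
    Tendsto (fun P => ∑ p ∈ Finset.range P, γ p) atTop atTop ∧
    ∀ y ∈ D.feasibleGains, ∀ xs, D.IsSubSolution d cbar y xs → ∃ us, D.IsRegular (xs, us)

end Data

end GainDesign

end

noncomputable section

namespace GainDesign

/-! In an eigenbasis of `X`, every function of the gains depends only on `s = x₁ + x₂` and is a sum
`∑ₖ cₖ / (λₖ + s) ^ p` up to a constant. All derivatives, surrogates and curvature bounds thus
become explicit one-variable formulas.

The constraint surrogates are convex upper bounds that agree with the constraints to first order at
the base point. Each subproblem is therefore a convex inner approximation, and damped steps stay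
feasible. Optimality of `xs` against the base point `y`, with a quadratic bound on `U`, gives for
all late steps the decrease `U(x_{p+1}) ≤ U(x_p) - a γ_p ‖δ_p‖²`, where `δ_p = xs_p - x_p`
(`stepRule_descent`).

Suppose a regular limit point is not stationary. By a theorem of the alternative, some direction
decreases the linearized objective and makes all linearized constraints negative
(`IsRegular.isStationary`). A short move along it gives a strictly feasible, improving point of the
subproblem there (`exists_improving_point`). By continuity this point serves for all nearby base
points, which keeps `‖δ_p‖` above some `κ > 0` near the limit point
(`exists_lower_bound_direction`). With `∑ γ_p = ∞` this contradicts the decrease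
(`not_bounded_below_near_clusterPt`). No convergence of multipliers or of auxiliary variables is
needed.

Strict decrease along the iterates excludes a local maximum on `𝒳`; the nonzero gradient of `U`
excludes one on the plane. -/

/-! ### General tools: quadratic bounds, alternatives, descent sequences -/

/-- A quadratic upper bound for a function whose derivative grows at most linearly. -/
theorem le_quadratic_of_deriv_sub_le {I : Set ℝ} (hI : Convex ℝ I) {f f' : ℝ → ℝ} {C : ℝ}
    (hf : ∀ t ∈ I, HasDerivAt f (f' t) t)
    (hC : ∀ s ∈ I, ∀ t ∈ I, s ≤ t → f' t - f' s ≤ C * (t - s)) {s t : ℝ} (hs : s ∈ I)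
    (ht : t ∈ I) : f t ≤ f s + f' s * (t - s) + C / 2 * (t - s) ^ 2 := by
  -- The difference with the parabola has derivative at most `0` to the right of `s` and at least
  -- `0` to the left, hence is maximal at `s`.
  set g : ℝ → ℝ := fun τ => f τ - f' s * (τ - s) - C / 2 * (τ - s) ^ 2 with hg
  have hd : ∀ τ ∈ I, HasDerivAt g (f' τ - f' s - C * (τ - s)) τ := fun τ hτ => by
    have h1 := (hasDerivAt_id τ).sub_const s
    have := ((hf τ hτ).sub (h1.const_mul (f' s))).sub ((h1.pow 2).const_mul (C / 2))
    refine this.congr_deriv ?_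
    simp
    ring
  have key : g t ≤ g s := by
    rcases le_total s t with h | h
    · have hsub : Set.Icc s t ⊆ I := hI.ordConnected.out hs ht
      refine antitoneOn_of_deriv_nonpos (convex_Icc s t)
        (fun τ hτ => (hd τ (hsub hτ)).continuousAt.continuousWithinAt)
        (fun τ hτ => (hd τ (hsub (interior_subset hτ))).differentiableAt.differentiableWithinAt)
        (fun τ hτ => ?_) (Set.left_mem_Icc.2 h) (Set.right_mem_Icc.2 h) h
      have hτ' := interior_subset hτ
      rw [(hd τ (hsub hτ')).deriv]
      linarith [hC s hs τ (hsub hτ') hτ'.1]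
    · have hsub : Set.Icc t s ⊆ I := hI.ordConnected.out ht hs
      refine monotoneOn_of_deriv_nonneg (convex_Icc t s)
        (fun τ hτ => (hd τ (hsub hτ)).continuousAt.continuousWithinAt)
        (fun τ hτ => (hd τ (hsub (interior_subset hτ))).differentiableAt.differentiableWithinAt)
        (fun τ hτ => ?_) (Set.left_mem_Icc.2 h) (Set.right_mem_Icc.2 h) h
      have hτ' := interior_subset hτ
      rw [(hd τ (hsub hτ')).deriv]
      linarith [hC τ (hsub hτ') s hs hτ'.2]
  simp only [hg, sub_self] at key
  linarith

/-- A bound on the derivative bounds the growth of the function. -/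
theorem sub_le_of_hasDerivAt_le {I : Set ℝ} (hI : Convex ℝ I) {f f' : ℝ → ℝ} {C : ℝ}
    (hf : ∀ t ∈ I, HasDerivAt f (f' t) t) (hC : ∀ t ∈ I, f' t ≤ C) :
    ∀ s ∈ I, ∀ t ∈ I, s ≤ t → f t - f s ≤ C * (t - s) := fun s hs t ht hst =>
  hI.image_sub_le_mul_sub_of_deriv_le
    (fun τ hτ => (hf τ hτ).continuousAt.continuousWithinAt)
    (fun τ hτ => (hf τ (interior_subset hτ)).differentiableAt.differentiableWithinAt)
    (fun τ hτ => (hf τ (interior_subset hτ)).deriv.trans_le (hC τ (interior_subset hτ)))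
    s hs t ht hst

/-- Theorem of the alternative for finitely many convex functions: if they are not simultaneously
negative, some nontrivial nonnegative combination of them is nonnegative. -/
theorem exists_nonneg_combination {E ι : Type*} [AddCommGroup E] [Module ℝ E] [Fintype ι]
    {C : Set E} {T : ι → E → ℝ} (hne : C.Nonempty) (hT : ∀ i, ConvexOn ℝ C (T i)) (hC : Convex ℝ C)
    (h : ∀ y ∈ C, ∃ i, 0 ≤ T i y) :
    ∃ μ : ι → ℝ, (∀ i, 0 ≤ μ i) ∧ μ ≠ 0 ∧ ∀ y ∈ C, 0 ≤ ∑ i, μ i * T i y := by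
  classical
  let S : Set (ι → ℝ) := {w | ∀ i, w i < 0}
  -- Taking all vectors above values of `T`, rather than the values alone, makes the set convex; it
  -- misses the open negative orthant `S`, and Hahn-Banach separates the two.
  let V : Set (ι → ℝ) := {w | ∃ y ∈ C, ∀ i, T i y ≤ w i}
  have hS : Convex ℝ S := by
    intro v hv w hw a c ha hc hac i
    have h1 := hv i
    have h2 := hw i
    simp only [Pi.add_apply, Pi.smul_apply, smul_eq_mul]
    rcases ha.eq_or_lt with rfl | ha
    · simp_all
    · nlinarith
  have hSo : IsOpen S := by
    have : S = ⋂ i, {w | w i < 0} := by ext; simp [S]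
    rw [this]
    exact isOpen_iInter_of_finite fun i => isOpen_lt (continuous_apply i) continuous_const
  have hV : Convex ℝ V := by
    rintro v ⟨y, hy, hv⟩ w ⟨z, hz, hw⟩ a c ha hc hac
    refine ⟨a • y + c • z, hC hy hz ha hc hac, fun i => ((hT i).2 hy hz ha hc hac).trans ?_⟩
    simp only [Pi.add_apply, Pi.smul_apply, smul_eq_mul]
    gcongr
    · exact hv i
    · exact hw i
  have hd : Disjoint S V := Set.disjoint_left.2 fun w hw ⟨y, hy, hyw⟩ => by
    obtain ⟨i, hi⟩ := h y hy
    exact absurd (hi.trans (hyw i)) (not_le.2 (hw i))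
  obtain ⟨f, c, hfS, hfV⟩ := geometric_hahn_banach_open hS hSo hV hd
  have hf : ∀ w, f w = ∑ i, f (Pi.single i 1) * w i := fun w => by
    conv_lhs => rw [← Finset.univ_sum_single w]
    rw [map_sum]
    refine Finset.sum_congr rfl fun i _ => ?_
    have : (Pi.single i (w i) : ι → ℝ) = w i • Pi.single i 1 := by
      rw [← Pi.single_smul, smul_eq_mul, mul_one]
    rw [this, map_smul, smul_eq_mul, mul_comm]
  have hcl : ∀ w : ι → ℝ, (∀ i, w i ≤ 0) → f w ≤ c := fun w hw => by
    have ht : Tendsto (fun τ : ℝ => f (w - τ • 1)) (𝓝[>] 0) (𝓝 (f w)) := by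
      have : Continuous fun τ : ℝ => f (w - τ • 1) := by fun_prop
      simpa using (this.tendsto 0).mono_left nhdsWithin_le_nhds
    refine le_of_tendsto ht (eventually_mem_nhdsWithin.mono fun τ hτ => (hfS _ fun i => ?_).le)
    have := hw i
    have : (0 : ℝ) < τ := hτ
    simp
    linarith
  have hc : 0 ≤ c := by simpa using hcl 0 (by simp)
  have hpos : ∀ i, 0 ≤ f (Pi.single i 1) := fun i => by
    by_contra! hi
    -- If this coefficient were negative, the chosen multiple of the basis vector would lie in the
    -- closed negative orthant (as `c ≥ 0`) and have value `c + 1 > c`.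
    have h1 := hcl (((c + 1) / f (Pi.single i 1)) • Pi.single i 1) fun j => by
      have : (c + 1) / f (Pi.single i 1) ≤ 0 := div_nonpos_of_nonneg_of_nonpos (by linarith) hi.le
      rcases eq_or_ne j i with rfl | hj
      · simpa using this
      · simp [hj]
    rw [map_smul, smul_eq_mul, div_mul_cancel₀ _ hi.ne] at h1
    linarith
  refine ⟨fun i => f (Pi.single i 1), hpos, fun h0 => ?_, fun y hy => ?_⟩
  -- A zero functional cannot separate: the strict bound on `S` gives `0 < c`, the bound on `V`
  -- gives `c ≤ 0`.
  · have hf0 : ∀ w, f w = 0 := fun w => by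
      rw [hf]
      exact Finset.sum_eq_zero fun i _ => by rw [show f (Pi.single i 1) = 0 from congrFun h0 i,
        zero_mul]
    obtain ⟨y, hy⟩ := hne
    have h1 := hfS (fun _ => -1) fun i => by norm_num
    have h2 := hfV (fun i => T i y) ⟨y, hy, fun i => le_rfl⟩
    rw [hf0] at h1 h2
    linarith
  · have := hfV (fun i => T i y) ⟨y, hy, fun i => le_rfl⟩
    rw [hf] at this
    linarith

/-- A sequence with steps `γ p • δ p`, `∑ γ p = ∞`, along which a nonnegative quantity decreases by
at least `a γ p ‖δ p‖²`, has no cluster point near which the directions `δ p` stay away from `0`. -/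
theorem not_bounded_below_near_clusterPt {E : Type*} [NormedAddCommGroup E] [NormedSpace ℝ E]
    {x δ : ℕ → E} {γ V : ℕ → ℝ} {a r κ : ℝ} {P : ℕ} {z : E} (ha : 0 < a) (hr : 0 < r) (hκ : 0 < κ)
    (hγ : ∀ p, 0 ≤ γ p) (hsum : Tendsto (fun P => ∑ p ∈ Finset.range P, γ p) atTop atTop)
    (hx : ∀ p, x (p + 1) = x p + γ p • δ p) (hV : ∀ p, 0 ≤ V p)
    (hdec : ∀ p ≥ P, V (p + 1) ≤ V p - a * γ p * ‖δ p‖ ^ 2) (hz : MapClusterPt z atTop x) :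
    ¬ ∀ p, ‖x p - z‖ < r → κ ≤ ‖δ p‖ := by
  intro hδ
  have hanti : Antitone fun p => V (p + P) := antitone_nat_of_succ_le fun p => by
    have h1 := hdec (p + P) (by omega)
    have h2 : 0 ≤ a * γ (p + P) * ‖δ (p + P)‖ ^ 2 :=
      mul_nonneg (mul_nonneg ha.le (hγ _)) (sq_nonneg _)
    rw [show p + 1 + P = p + P + 1 by omega]
    linarith
  have hlim := tendsto_atTop_ciInf hanti ⟨0, by rintro _ ⟨p, rfl⟩; exact hV _⟩
  set v := ⨅ p, V (p + P)
  have hge : ∀ p ≥ P, v ≤ V p := fun p hp => by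
    have := hanti.le_of_tendsto hlim (p - P)
    simpa [Nat.sub_add_cancel hp] using this
  have hη : 0 < a * κ * (r / 2) := by positivity
  have hev : ∀ᶠ p in atTop, V p < v + a * κ * (r / 2) :=
    ((tendsto_add_atTop_iff_nat (f := V) P).1 hlim).eventually_lt_const (by linarith)
  have hball : ∃ᶠ p in atTop, ‖x p - z‖ < r / 2 :=
    (hz.frequently (Metric.ball_mem_nhds z (half_pos hr))).mono fun p hp => by
      rwa [← dist_eq_norm]
  -- Start within `r / 2` of `z`, with less than `a κ r / 2` of decrease left. While the sequence is
  -- in the ball, `‖δ‖ ≥ κ`, so each step costs at least `a κ` times its length; the remaining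
  -- displacement is below `r / 2` and the sequence never leaves.
  obtain ⟨k, hk, hkv, hkP⟩ := (hball.and_eventually (hev.and (eventually_ge_atTop P))).exists
  have hstay : ∀ p, a * κ * ‖x (k + p) - x k‖ ≤ V k - V (k + p) ∧ ‖x (k + p) - z‖ < r := by
    have aux : ∀ p, a * κ * ‖x (k + p) - x k‖ ≤ V k - V (k + p) → ‖x (k + p) - z‖ < r := by
      intro p hp
      have h1 := hge (k + p) (by omega)
      have h2 : a * κ * ‖x (k + p) - x k‖ < a * κ * (r / 2) := by linarith
      have h3 := lt_of_mul_lt_mul_left h2 (by positivity)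
      have h4 := norm_add_le (x (k + p) - x k) (x k - z)
      rw [sub_add_sub_cancel] at h4
      linarith
    intro p
    induction p with
    | zero => exact ⟨by simp, by simpa using by linarith⟩
    | succ p ih =>
      have key : a * κ * ‖x (k + (p + 1)) - x k‖ ≤ V k - V (k + (p + 1)) := by
        have h1 := hdec (k + p) (by omega)
        have h2 := hδ _ ih.2
        have h3 : ‖x (k + (p + 1)) - x k‖ ≤ ‖x (k + p) - x k‖ + γ (k + p) * ‖δ (k + p)‖ := by
          rw [← add_assoc, hx, add_sub_right_comm]
          refine (norm_add_le _ _).trans ?_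
          rw [norm_smul, Real.norm_of_nonneg (hγ _)]
        have h4 : a * κ * (γ (k + p) * ‖δ (k + p)‖) ≤ a * γ (k + p) * ‖δ (k + p)‖ ^ 2 := by
          have : 0 ≤ a * γ (k + p) * ‖δ (k + p)‖ :=
            mul_nonneg (mul_nonneg ha.le (hγ _)) (norm_nonneg _)
          nlinarith
        have h5 := mul_le_mul_of_nonneg_left h3 (show 0 ≤ a * κ by positivity)
        have h6 := ih.1
        rw [show k + (p + 1) = k + p + 1 by omega] at *
        linarith
      exact ⟨key, aux _ key⟩
  have hbound : ∀ p, a * κ ^ 2 * ∑ i ∈ Finset.range p, γ (k + i) ≤ V k - V (k + p) := by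
    intro p
    induction p with
    | zero => simp
    | succ p ih =>
      rw [Finset.sum_range_succ, mul_add]
      have h1 := hdec (k + p) (by omega)
      have h2 := hδ _ (hstay p).2
      have h3 : a * κ ^ 2 * γ (k + p) ≤ a * γ (k + p) * ‖δ (k + p)‖ ^ 2 := by
        have := pow_le_pow_left₀ hκ.le h2 2
        have h0 : 0 ≤ a * γ (k + p) := mul_nonneg ha.le (hγ _)
        nlinarith
      rw [← add_assoc]
      linarith
  have hac : 0 < a * κ ^ 2 := by positivity
  obtain ⟨p, hp1, hp2⟩ := ((hsum.eventually_gt_atTop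
    (∑ i ∈ Finset.range k, γ i + V k / (a * κ ^ 2))).and (eventually_ge_atTop k)).exists
  obtain ⟨m, rfl⟩ := Nat.exists_eq_add_of_le hp2
  rw [Finset.sum_range_add] at hp1
  have h1 : V k / (a * κ ^ 2) < ∑ i ∈ Finset.range m, γ (k + i) := by linarith
  rw [div_lt_iff₀ hac] at h1
  linarith [hbound m, hV (k + m)]

/-- If `f 0 ≤ 0` and `f 0 + f' 0 < 0`, then `f` is negative on some interval `(0, δ)`. -/
theorem eventually_neg_of_hasDerivAt {f : ℝ → ℝ} {f' : ℝ} (hf : HasDerivAt f f' 0) (h0 : f 0 ≤ 0)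
    (h : f 0 + f' < 0) : ∀ᶠ t in 𝓝[>] (0 : ℝ), f t < 0 := by
  -- For `0 < t < 1`, `f 0 ≤ t * f 0`, so `f t ≤ t * (f 0 + f') + o(t)`; half of the gap absorbs the
  -- error. This handles active and inactive constraints alike.
  have hlo := (hasDerivAt_iff_isLittleO.1 hf).def (show 0 < -(f 0 + f') / 2 by linarith)
  have h1 : ∀ᶠ t in 𝓝 (0 : ℝ), t < 1 := gt_mem_nhds one_pos
  filter_upwards [hlo.filter_mono nhdsWithin_le_nhds, h1.filter_mono nhdsWithin_le_nhds,
    eventually_mem_nhdsWithin] with t ht ht1 ht0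
  have ht0' : (0 : ℝ) < t := ht0
  simp only [sub_zero, smul_eq_mul, Real.norm_eq_abs, abs_of_pos ht0'] at ht
  have := (abs_le.1 ht).2
  nlinarith

/-- The linear functional `x ↦ x₁ + x₂`. -/
def gainSum : Gains →L[ℝ] ℝ := EuclideanSpace.proj 0 + EuclideanSpace.proj 1

@[simp] theorem gainSum_apply (x : Gains) : gainSum x = x 0 + x 1 := rfl

theorem gainSum_sq_le (v : Gains) : gainSum v ^ 2 ≤ 2 * ‖v‖ ^ 2 := by
  rw [EuclideanSpace.real_norm_sq_eq, Fin.sum_univ_two, gainSum_apply]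
  nlinarith [sq_nonneg (v 0 - v 1)]

/-- The coordinate functional `(x, u) ↦ uⱼ`. -/
def auxCoord {N b : ℕ} (j : Idx N b) : Var N b →L[ℝ] ℝ :=
  ContinuousLinearMap.proj (R := ℝ) (φ := fun _ : Idx N b => ℝ) j ∘L
    ContinuousLinearMap.snd ℝ Gains (Idx N b → ℝ)

/-- The value at a cluster point bounds an eventually decreasing sequence of values from below. -/
theorem le_of_mapClusterPt {E : Type*} [TopologicalSpace E] {f : E → ℝ}
    {x : ℕ → E} {z : E} (hf : ContinuousAt f z) (hz : MapClusterPt z atTop x) {P : ℕ}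
    (hanti : ∀ p ≥ P, f (x (p + 1)) ≤ f (x p)) {p : ℕ} (hp : P ≤ p) : f z ≤ f (x p) := by
  have hmono : ∀ q ≥ p, f (x q) ≤ f (x p) := fun q hq => by
    induction q, hq using Nat.le_induction with
    | base => exact le_rfl
    | succ q hq ih => exact (hanti q (hp.trans hq)).trans ih
  by_contra! hlt
  obtain ⟨q, hq1, hq2⟩ := ((hz.frequently (hf.eventually_const_lt hlt)).and_eventually
    (eventually_ge_atTop p)).exists
  exact absurd (hmono q hq2) (not_le.2 hq1)

namespace Data

section

variable {N b Ns : ℕ} (D : Data N b Ns)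

/-! ### Spectral form of the problem -/

/-- The eigenvalues of `X`. -/
def lam : Fin N → ℝ := D.X_posDef.isHermitian.eigenvalues

theorem lam_pos (k : Fin N) : 0 < D.lam k := D.X_posDef.eigenvalues_pos k

/-- An orthonormal basis of eigenvectors of `X`. -/
def eig : OrthonormalBasis (Fin N) ℝ (EuclideanSpace ℝ (Fin N)) :=
  D.X_posDef.isHermitian.eigenvectorBasis

theorem X_mulVec_eig (k : Fin N) : D.X *ᵥ (D.eig k).ofLp = D.lam k • (D.eig k).ofLp :=
  D.X_posDef.isHermitian.mulVec_eigenvectorBasis k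

/-- The vector with coordinates `c` in the eigenbasis. -/
def modal (c : Fin N → ℝ) : EuclideanSpace ℝ (Fin N) := ∑ k, c k • D.eig k

theorem modal_apply (c : Fin N → ℝ) (n : Fin N) : D.modal c n = ∑ k, c k * D.eig k n := by
  simp [modal]

theorem ofLp_modal (c : Fin N → ℝ) : (D.modal c).ofLp = ∑ k, c k • (D.eig k).ofLp := by
  simp [modal]

theorem norm_modal_sq (c : Fin N → ℝ) : ‖D.modal c‖ ^ 2 = ∑ k, c k ^ 2 := by
  rw [← D.eig.sum_sq_norm_inner_right]
  refine Finset.sum_congr rfl fun k _ => ?_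
  rw [modal, D.eig.orthonormal.inner_right_fintype]
  simp

theorem X_mulVec_modal (c : Fin N → ℝ) :
    D.X *ᵥ (D.modal c).ofLp = (D.modal fun k => D.lam k * c k).ofLp := by
  simp only [ofLp_modal, Matrix.mulVec_sum, Matrix.mulVec_smul, X_mulVec_eig, smul_smul, mul_comm]

theorem shift_mulVec_modal (s : ℝ) (c : Fin N → ℝ) :
    (D.X + s • (1 : Matrix (Fin N) (Fin N) ℝ)) *ᵥ (D.modal c).ofLp =
      (D.modal fun k => (D.lam k + s) * c k).ofLp := by
  rw [Matrix.add_mulVec, X_mulVec_modal, Matrix.smul_mulVec, Matrix.one_mulVec]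
  simp only [ofLp_modal, Finset.smul_sum, ← Finset.sum_add_distrib, smul_smul, ← add_smul, add_mul]

theorem exists_modal (v : Fin N → ℝ) : ∃ c, (D.modal c).ofLp = v :=
  ⟨fun k => inner ℝ (D.eig k) (WithLp.toLp 2 v), by rw [modal, D.eig.sum_repr']⟩

/-- In the eigenbasis the matrix is diagonal with entries `λₖ + s > 0`, so its kernel is trivial. -/
theorem isUnit_shift {s : ℝ} (hs : ∀ k, 0 < D.lam k + s) :
    IsUnit (D.X + s • (1 : Matrix (Fin N) (Fin N) ℝ)) := by
  rw [← Matrix.mulVec_injective_iff_isUnit]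
  refine (injective_iff_map_eq_zero
    (Matrix.mulVecLin (D.X + s • (1 : Matrix (Fin N) (Fin N) ℝ)))).2 fun v hv => ?_
  obtain ⟨c, rfl⟩ := D.exists_modal v
  rw [Matrix.mulVecLin_apply, shift_mulVec_modal] at hv
  have h1 : D.modal (fun k => (D.lam k + s) * c k) = 0 := by ext n; exact congrFun hv n
  have h2 := D.norm_modal_sq fun k => (D.lam k + s) * c k
  rw [h1, norm_zero, zero_pow two_ne_zero, eq_comm,
    Finset.sum_eq_zero_iff_of_nonneg fun _ _ => sq_nonneg _] at h2
  have h3 : ∀ k, c k = 0 := fun k => by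
    have := h2 k (Finset.mem_univ k)
    simpa [(hs k).ne'] using this
  simp [ofLp_modal, h3]

theorem shift_inv_mulVec_modal {s : ℝ} (hs : ∀ k, 0 < D.lam k + s) (c : Fin N → ℝ) :
    (D.X + s • (1 : Matrix (Fin N) (Fin N) ℝ))⁻¹ *ᵥ (D.modal c).ofLp =
      (D.modal fun k => c k / (D.lam k + s)).ofLp := by
  have h1 : (D.modal c).ofLp = (D.X + s • (1 : Matrix (Fin N) (Fin N) ℝ)) *ᵥ
      (D.modal fun k => c k / (D.lam k + s)).ofLp := by
    rw [shift_mulVec_modal]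
    congr 2
    ext k
    rw [mul_div_cancel₀ _ (hs k).ne']
  rw [h1, Matrix.mulVec_mulVec, Matrix.nonsing_inv_mul _
    ((Matrix.isUnit_iff_isUnit_det _).1 (D.isUnit_shift hs)), Matrix.one_mulVec]

/-- The coordinates of `𝟙 - ρ` in the eigenbasis. -/
def coef (ρ : Fin N → ℝ) (k : Fin N) : ℝ := inner ℝ (D.eig k) (WithLp.toLp 2 fun n => 1 - ρ n)

theorem modal_coef (ρ : Fin N → ℝ) : (D.modal (D.coef ρ)).ofLp = fun n => 1 - ρ n := by
  simp only [modal, coef]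
  rw [D.eig.sum_repr']

/-- The values `s` of `x₁ + x₂` for which `X + s I` is positive definite. -/
def dom : Set ℝ := {s | ∀ k, 0 < D.lam k + s}

/-- Openness lets the spectral formulas be differentiated at every point of `𝒦`, including those
with `x₁ + x₂ = 0` on its boundary. -/
theorem isOpen_dom : IsOpen D.dom := by
  have : D.dom = ⋂ k, {s | 0 < D.lam k + s} := by ext; simp [dom]
  rw [this]
  exact isOpen_iInter_of_finite fun k => isOpen_lt continuous_const (by fun_prop)

theorem mem_dom_of_nonneg {s : ℝ} (hs : 0 ≤ s) : s ∈ D.dom := fun k => by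
  linarith [D.lam_pos k]

theorem eventually_mem_dom {x : Gains} (hx : gainSum x ∈ D.dom) :
    ∀ᶠ y in 𝓝 x, gainSum y ∈ D.dom :=
  gainSum.continuous.continuousAt.eventually (D.isOpen_dom.mem_nhds hx)

theorem q_eq (ρ : Fin N → ℝ) {x : Gains} (hx : gainSum x ∈ D.dom) :
    D.q ρ x = D.modal fun k => D.coef ρ k / (D.lam k + gainSum x) := by
  rw [q, ← modal_coef, ← gainSum_apply, D.shift_inv_mulVec_modal hx]

/-- The rational function `s ↦ ∑ₖ cₖ / (λₖ + s) ^ p`. -/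
def pole (c : Fin N → ℝ) (p : ℕ) (s : ℝ) : ℝ := ∑ k, c k / (D.lam k + s) ^ p

theorem hasDerivAt_pole (c : Fin N → ℝ) (p : ℕ) {s : ℝ} (hs : s ∈ D.dom) :
    HasDerivAt (D.pole c p) (-p * D.pole c (p + 1) s) s := by
  unfold pole
  rw [Finset.mul_sum]
  refine HasDerivAt.fun_sum fun k _ => ?_
  have h0 : D.lam k + s ≠ 0 := (hs k).ne'
  have h1 : HasDerivAt (fun t : ℝ => (D.lam k + t) ^ p) (p * (D.lam k + s) ^ (p - 1) * 1) s :=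
    ((hasDerivAt_id s).const_add (D.lam k)).fun_pow p
  refine ((h1.fun_inv (pow_ne_zero _ h0)).const_mul (c k)).congr_deriv ?_
  -- The case `p = 0` is separate because of the truncated exponent `p - 1`.
  rcases p with _ | p
  · simp
  · simp only [Nat.add_sub_cancel]
    field_simp
    ring

/-- The residues of `h_{i,n}` as a function of `x₁ + x₂`. -/
def residue (i : Fin 4) (n : Fin N) (ρ : Fin N → ℝ) (k : Fin N) : ℝ :=
  match i with
  | 0 => D.coef ρ k * D.eig k n
  | 1 => -(D.coef ρ k * D.eig k n)
  | 2 => D.lam k * D.coef ρ k * D.eig k n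
  | 3 => -(D.lam k * D.coef ρ k * D.eig k n)

/-- The constant part of `h_{i,n}`. -/
def offset (i : Fin 4) (n : Fin N) (ρ : Fin N → ℝ) : ℝ :=
  match i with
  | 0 => -D.qmax n
  | 1 => D.qmin n
  | 2 => ρ n - D.νmax n
  | 3 => -ρ n + D.νmin n

theorem h_eq (i : Fin 4) (n : Fin N) (ρ : Fin N → ℝ) {x : Gains} (hx : gainSum x ∈ D.dom) :
    D.h i n ρ x = D.offset i n ρ + D.pole (D.residue i n ρ) 1 (gainSum x) := by
  have h1 : D.q ρ x n = ∑ k, D.coef ρ k * D.eig k n / (D.lam k + gainSum x) ^ 1 := by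
    rw [D.q_eq ρ hx, modal_apply]
    exact Finset.sum_congr rfl fun k _ => by rw [pow_one, div_mul_eq_mul_div]
  have h2 : (D.X *ᵥ (D.q ρ x).ofLp) n =
      ∑ k, D.lam k * D.coef ρ k * D.eig k n / (D.lam k + gainSum x) ^ 1 := by
    rw [D.q_eq ρ hx, X_mulVec_modal, modal_apply]
    exact Finset.sum_congr rfl fun k _ => by rw [pow_one]; ring
  match i with
  | 0 | 1 | 2 | 3 => simp only [h, pole, residue, offset, h1, h2, neg_div, Finset.sum_neg_distrib]; ring

theorem curvature_eq (i : Fin 4) (n : Fin N) (ρ : Fin N → ℝ) {x : Gains}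
    (hx : gainSum x ∈ D.dom) :
    D.curvature i n ρ x = 2 * D.pole (D.residue i n ρ) 3 (gainSum x) := by
  have h0 : ((D.X + (x 0 + x 1) • (1 : Matrix (Fin N) (Fin N) ℝ))⁻¹ ^ 3) *ᵥ (fun n => 1 - ρ n) =
      (D.modal fun k => D.coef ρ k / (D.lam k + gainSum x) ^ 3).ofLp := by
    rw [← modal_coef, ← gainSum_apply, pow_three, ← Matrix.mulVec_mulVec, ← Matrix.mulVec_mulVec,
      D.shift_inv_mulVec_modal hx, D.shift_inv_mulVec_modal hx, D.shift_inv_mulVec_modal hx]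
    congr 2
    ext k
    rw [div_div, div_div, ← pow_two, ← pow_succ']
  match i with
  | 0 | 1 | 2 | 3 => simp only [curvature, pole, residue, h0, neg_div, Finset.sum_neg_distrib, Matrix.mulVec_smul, X_mulVec_modal, Pi.smul_apply,
      smul_eq_mul, modal_apply, mul_neg, div_mul_eq_mul_div, mul_div_assoc']

theorem hasFDerivAt_pole_gainSum (c : Fin N → ℝ) (p : ℕ) {x : Gains} (hx : gainSum x ∈ D.dom) :
    HasFDerivAt (fun y => D.pole c p (gainSum y))
      ((-p * D.pole c (p + 1) (gainSum x)) • gainSum) x :=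
  (D.hasDerivAt_pole c p hx).comp_hasFDerivAt x gainSum.hasFDerivAt

theorem hasFDerivAt_h (i : Fin 4) (n : Fin N) (ρ : Fin N → ℝ) {x : Gains}
    (hx : gainSum x ∈ D.dom) :
    HasFDerivAt (D.h i n ρ) ((-D.pole (D.residue i n ρ) 2 (gainSum x)) • gainSum) x := by
  have h1 := (D.hasFDerivAt_pole_gainSum (D.residue i n ρ) 1 hx).const_add (D.offset i n ρ)
  refine (h1.congr_of_eventuallyEq
    ((D.eventually_mem_dom hx).mono fun y hy => D.h_eq i n ρ hy)).congr_fderiv ?_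
  simp

theorem hasFDerivAt_q (ρ : Fin N → ℝ) {x : Gains} (hx : gainSum x ∈ D.dom) :
    HasFDerivAt (D.q ρ)
      (gainSum.smulRight (D.modal fun k => -(D.coef ρ k / (D.lam k + gainSum x) ^ 2))) x := by
  have h1 : HasDerivAt (fun s => D.modal fun k => D.coef ρ k / (D.lam k + s))
      (D.modal fun k => -(D.coef ρ k / (D.lam k + gainSum x) ^ 2)) (gainSum x) := by
    unfold modal
    refine HasDerivAt.fun_sum fun k _ => HasDerivAt.smul_const ?_ _
    have h0 : D.lam k + gainSum x ≠ 0 := (hx k).ne'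
    refine ((((hasDerivAt_id (gainSum x)).const_add (D.lam k)).fun_inv h0).const_mul
      (D.coef ρ k)).congr_deriv ?_
    simp only [id]
    ring
  refine ((h1.hasFDerivAt.comp x gainSum.hasFDerivAt).congr_of_eventuallyEq
    ((D.eventually_mem_dom hx).mono fun y hy => D.q_eq ρ hy)).congr_fderiv ?_
  ext v
  simp

theorem h0_eq (ρ : Fin N → ℝ) {x : Gains} (hx : gainSum x ∈ D.dom) :
    D.h0 ρ x = D.pole (fun k => D.coef ρ k ^ 2) 2 (gainSum x) := by
  rw [h0, D.q_eq ρ hx, norm_modal_sq, pole]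
  simp only [div_pow]

/-- Linearizing `q` before squaring leaves the coefficient `pole 4` on the quadratic term, where the
Taylor expansion of `h₀` has `3 * pole 4`. The surrogate need not be an upper bound of `h₀`, so
descent depends on the step size. -/
theorem h0Sur_eq (d : ℝ) (ρ : Fin N → ℝ) {y : Gains} (hy : gainSum y ∈ D.dom) (x : Gains) :
    D.h0Sur d ρ y x = D.pole (fun k => D.coef ρ k ^ 2) 2 (gainSum y) -
      2 * D.pole (fun k => D.coef ρ k ^ 2) 3 (gainSum y) * gainSum (x - y) +
      D.pole (fun k => D.coef ρ k ^ 2) 4 (gainSum y) * gainSum (x - y) ^ 2 +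
      d / 2 * ‖x - y‖ ^ 2 := by
  set s := gainSum y
  set t := gainSum (x - y)
  have h1 : D.q ρ y + fderiv ℝ (D.q ρ) y (x - y) =
      D.modal fun k => D.coef ρ k / (D.lam k + s) - t * (D.coef ρ k / (D.lam k + s) ^ 2) := by
    rw [(D.hasFDerivAt_q ρ hy).fderiv, D.q_eq ρ hy, ContinuousLinearMap.smulRight_apply]
    simp only [modal, Finset.smul_sum, ← Finset.sum_add_distrib, smul_smul, ← add_smul]
    refine Finset.sum_congr rfl fun k _ => ?_
    rw [mul_neg, ← sub_eq_add_neg]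
  rw [h0Sur, h1, norm_modal_sq]
  simp only [pole, Finset.mul_sum, Finset.sum_mul, ← Finset.sum_sub_distrib,
    ← Finset.sum_add_distrib]
  congr 1
  refine Finset.sum_congr rfl fun k _ => ?_
  have h0 : D.lam k + s ≠ 0 := (hy k).ne'
  field_simp
  ring

/-- The coefficients of the objective as a function of `x₁ + x₂`. -/
def weight (k : Fin N) : ℝ := ∑ m, (1 / (Ns : ℝ)) * ∑ s, D.coef (D.ρ m s) k ^ 2

theorem weight_nonneg (k : Fin N) : 0 ≤ D.weight k :=
  Finset.sum_nonneg fun _ _ => mul_nonneg (by positivity)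
    (Finset.sum_nonneg fun _ _ => sq_nonneg _)

/-- Sample averaging only changes the coefficients, identically for every order `p`, so the
objective and its surrogate share the single family `weight`. -/
theorem sum_pole_coef (p : ℕ) (s : ℝ) :
    ∑ m, (1 / (Ns : ℝ)) * ∑ j, D.pole (fun k => D.coef (D.ρ m j) k ^ 2) p s =
      D.pole D.weight p s := by
  simp only [pole, weight, Finset.sum_div, Finset.mul_sum]
  rw [Finset.sum_comm (s := Finset.univ (α := Fin N))]
  refine Finset.sum_congr rfl fun m _ => ?_
  rw [Finset.sum_comm]
  simp only [mul_div_assoc]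

theorem objective_eq {x : Gains} (hx : gainSum x ∈ D.dom) :
    D.objective x = D.pole D.weight 2 (gainSum x) := by
  rw [objective, ← sum_pole_coef]
  simp only [D.h0_eq _ hx]

/-- The proximal terms add up to `b * d / 2`: the average over the samples keeps a constant (here
`Ns > 0` matters), and the sum over the intervals multiplies it by `b`. -/
theorem objectiveSur_eq (hNs : 0 < Ns) (d : ℝ) {y : Gains} (hy : gainSum y ∈ D.dom) (x : Gains) :
    D.objectiveSur d y x = D.pole D.weight 2 (gainSum y) -
      2 * D.pole D.weight 3 (gainSum y) * gainSum (x - y) +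
      D.pole D.weight 4 (gainSum y) * gainSum (x - y) ^ 2 + b * d / 2 * ‖x - y‖ ^ 2 := by
  have hN : (Ns : ℝ) ≠ 0 := by positivity
  have key : ∀ (A B C : Fin Ns → ℝ) (t e : ℝ), 1 / (Ns : ℝ) * ∑ s, (A s - 2 * B s * t +
      C s * t ^ 2 + e) = 1 / (Ns : ℝ) * ∑ s, A s - 2 * t * (1 / (Ns : ℝ) * ∑ s, B s) +
      t ^ 2 * (1 / (Ns : ℝ) * ∑ s, C s) + e := fun A B C t e => by
    simp only [Finset.sum_add_distrib, Finset.sum_sub_distrib, ← Finset.sum_mul, ← Finset.mul_sum,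
      Finset.sum_const, Finset.card_univ, Fintype.card_fin, nsmul_eq_mul]
    field_simp
  rw [objectiveSur, ← sum_pole_coef, ← sum_pole_coef, ← sum_pole_coef]
  simp only [D.h0Sur_eq d _ hy, key]
  simp only [Finset.sum_add_distrib, Finset.sum_sub_distrib, ← Finset.mul_sum, Finset.sum_const,
    Finset.card_univ, Fintype.card_fin, nsmul_eq_mul]
  ring

theorem hasFDerivAt_objective {x : Gains} (hx : gainSum x ∈ D.dom) :
    HasFDerivAt D.objective ((-2 * D.pole D.weight 3 (gainSum x)) • gainSum) x := by
  refine ((D.hasFDerivAt_pole_gainSum D.weight 2 hx).congr_of_eventuallyEq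
    ((D.eventually_mem_dom hx).mono fun y hy => D.objective_eq hy)).congr_fderiv ?_
  norm_num

/-! ### The surrogate constraints -/

theorem convex_K : Convex ℝ D.K := by
  rintro x ⟨hx1, hx2, hx3, hx4⟩ y ⟨hy1, hy2, hy3, hy4⟩ a c ha hc hac
  obtain rfl : c = 1 - a := by linarith
  simp only [K, Set.mem_ofPred_eq, PiLp.add_apply, PiLp.smul_apply, smul_eq_mul]
  refine ⟨fun n => ?_, ?_, ?_, ?_⟩
  · nlinarith [mul_nonneg ha (sub_nonneg.2 (hx1 n)), mul_nonneg hc (sub_nonneg.2 (hy1 n))]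
  all_goals nlinarith

theorem gainSum_nonneg {x : Gains} (hx : x ∈ D.K) : 0 ≤ gainSum x := by
  rw [gainSum_apply]
  linarith [hx.2.1]

/-- The index `n` guarantees that an eigenvalue constraint exists; for `N = 0`, `𝒦` does not bound
`x₁ + x₂` from above. -/
theorem gainSum_le_two {x : Gains} (hx : x ∈ D.K) (n : Fin N) : gainSum x ≤ 2 := by
  have := hx.1 n
  have h2 : 0 < D.X_posDef.isHermitian.eigenvalues n := D.lam_pos n
  rw [gainSum_apply]
  linarith

theorem gainSum_mem_dom {x : Gains} (hx : x ∈ D.K) : gainSum x ∈ D.dom :=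
  D.mem_dom_of_nonneg (D.gainSum_nonneg hx)

theorem dotProduct_surrogateMatrix (c : ℝ) (v : Gains) :
    v.ofLp ⬝ᵥ (surrogateMatrix c *ᵥ v.ofLp) = 2 * max 0 c * ‖v‖ ^ 2 := by
  rw [EuclideanSpace.real_norm_sq_eq, surrogateMatrix, Matrix.smul_mulVec, dotProduct_smul]
  simp [dotProduct, Matrix.mulVec_diagonal, Fin.sum_univ_two]
  ring

theorem hSur_eq (c : ℝ) (i : Fin 4) (n : Fin N) (ρ : Fin N → ℝ) {y : Gains}
    (hy : gainSum y ∈ D.dom) (x : Gains) :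
    D.hSur c i n ρ y x = D.offset i n ρ + D.pole (D.residue i n ρ) 1 (gainSum y) -
      D.pole (D.residue i n ρ) 2 (gainSum y) * gainSum (x - y) + 2 * max 0 c * ‖x - y‖ ^ 2 := by
  rw [hSur, dotProduct_surrogateMatrix, D.h_eq _ _ _ hy, (D.hasFDerivAt_h i n ρ hy).fderiv]
  simp only [_root_.smul_apply, smul_eq_mul]
  ring

theorem hSur_self (c : ℝ) (i : Fin 4) (n : Fin N) (ρ : Fin N → ℝ) (y : Gains) :
    D.hSur c i n ρ y y = D.h i n ρ y := by
  simp [hSur]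

/-- The surrogate of `h_{i,n}` is an upper bound on `𝒦`. -/
theorem h_le_hSur {c : ℝ} {i : Fin 4} {n : Fin N} {ρ : Fin N → ℝ}
    (hc : ∀ x ∈ D.K, D.curvature i n ρ x ≤ c) {x y : Gains} (hx : x ∈ D.K) (hy : y ∈ D.K) :
    D.h i n ρ x ≤ D.hSur c i n ρ y x := by
  set B := D.residue i n ρ
  have hI : Convex ℝ (gainSum '' D.K) := D.convex_K.linear_image gainSum.toLinearMap
  have hdom : ∀ s ∈ gainSum '' D.K, s ∈ D.dom := by
    rintro _ ⟨z, hz, rfl⟩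
    exact D.gainSum_mem_dom hz
  have h1 : ∀ s ∈ gainSum '' D.K, HasDerivAt (D.pole B 1) (-D.pole B 2 s) s := fun s hs =>
    (D.hasDerivAt_pole B 1 (hdom s hs)).congr_deriv (by norm_num)
  have h2 : ∀ s ∈ gainSum '' D.K, HasDerivAt (fun s => -D.pole B 2 s) (2 * D.pole B 3 s) s :=
    fun s hs => (D.hasDerivAt_pole B 2 (hdom s hs)).neg.congr_deriv (by norm_num)
  have h3 : ∀ s ∈ gainSum '' D.K, 2 * D.pole B 3 s ≤ c := by
    rintro _ ⟨z, hz, rfl⟩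
    rw [← D.curvature_eq _ _ _ (D.gainSum_mem_dom hz)]
    exact hc z hz
  have h4 := le_quadratic_of_deriv_sub_le hI h1 (sub_le_of_hasDerivAt_le hI h2 h3)
    (Set.mem_image_of_mem _ hy) (Set.mem_image_of_mem _ hx)
  rw [D.h_eq _ _ _ (D.gainSum_mem_dom hx), D.hSur_eq _ _ _ _ (D.gainSum_mem_dom hy)]
  rw [← map_sub] at h4
  have h5 := gainSum_sq_le (x - y)
  -- Since `(v₁ + v₂)² ≤ 2 ‖v‖²`, the term `max 0 c * ‖x - y‖²` would suffice; the surrogate has a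
  -- factor two to spare.
  have h6 : c / 2 * gainSum (x - y) ^ 2 ≤ 2 * max 0 c * ‖x - y‖ ^ 2 := by
    have := le_max_right 0 c
    have := le_max_left 0 c
    nlinarith [sq_nonneg (gainSum (x - y)), sq_nonneg ‖x - y‖]
  linarith

/-- Reading the square root as the norm of `(ξ, y)` turns monotonicity into the reverse triangle
inequality and convexity into the triangle inequality. -/
theorem smoothPos_eq (y : ℝ) :
    D.smoothPos y = (1 / 2) * (y + ‖!₂[D.ξ, (0 : ℝ)] + y • !₂[(0 : ℝ), 1]‖) := by
  rw [smoothPos, EuclideanSpace.norm_eq]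
  simp [Fin.sum_univ_two]

theorem smoothPos_mono : Monotone D.smoothPos := fun y z hyz => by
  simp only [smoothPos_eq]
  have h1 := norm_sub_norm_le (!₂[D.ξ, (0 : ℝ)] + y • !₂[(0 : ℝ), 1])
    (!₂[D.ξ, (0 : ℝ)] + z • !₂[(0 : ℝ), 1])
  rw [add_sub_add_left_eq_sub, ← sub_smul, norm_smul] at h1
  have h2 : ‖!₂[(0 : ℝ), 1]‖ = 1 := by simp [EuclideanSpace.norm_eq, Fin.sum_univ_two]
  rw [h2, mul_one, Real.norm_of_nonpos (sub_nonpos.2 hyz)] at h1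
  linarith

theorem smoothPos_convex {y z a c : ℝ} (ha : 0 ≤ a) (hc : 0 ≤ c) (hac : a + c = 1) :
    D.smoothPos (a * y + c * z) ≤ a * D.smoothPos y + c * D.smoothPos z := by
  simp only [smoothPos_eq]
  have h1 : !₂[D.ξ, (0 : ℝ)] + (a * y + c * z) • !₂[(0 : ℝ), 1] =
      a • (!₂[D.ξ, (0 : ℝ)] + y • !₂[(0 : ℝ), 1]) + c • (!₂[D.ξ, (0 : ℝ)] + z • !₂[(0 : ℝ), 1]) := by
    obtain rfl : c = 1 - a := by linarith
    module
  have h2 := norm_add_le (a • (!₂[D.ξ, (0 : ℝ)] + y • !₂[(0 : ℝ), 1]))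
    (c • (!₂[D.ξ, (0 : ℝ)] + z • !₂[(0 : ℝ), 1]))
  rw [norm_smul, norm_smul, Real.norm_of_nonneg ha, Real.norm_of_nonneg hc] at h2
  rw [h1]
  linarith

theorem hasDerivAt_smoothPos (y : ℝ) :
    HasDerivAt D.smoothPos (1 / 2 * (1 + 2 * y / (2 * Real.sqrt (D.ξ ^ 2 + y ^ 2)))) y := by
  have h0 : D.ξ ^ 2 + y ^ 2 ≠ 0 := by
    have := D.ξ_ne_zero
    positivity
  have h1 : HasDerivAt (fun t : ℝ => D.ξ ^ 2 + t ^ 2) (2 * y) y := by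
    simpa using (hasDerivAt_pow 2 y).const_add (D.ξ ^ 2)
  exact ((hasDerivAt_id y).add (h1.sqrt h0)).const_mul (1 / 2)

/-- The surrogate of `h_{i,n}` is convex. -/
theorem hSur_convex (c : ℝ) (i : Fin 4) (n : Fin N) (ρ : Fin N → ℝ) (y : Gains) {x z : Gains}
    {α β : ℝ} (ha : 0 ≤ α) (hb : 0 ≤ β) (hab : α + β = 1) :
    D.hSur c i n ρ y (α • x + β • z) ≤ α * D.hSur c i n ρ y x + β * D.hSur c i n ρ y z := by
  simp only [hSur, dotProduct_surrogateMatrix]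
  have h1 : α • x + β • z - y = α • (x - y) + β • (z - y) := by
    obtain rfl : β = 1 - α := by linarith
    module
  have h2 : ‖α • (x - y) + β • (z - y)‖ ^ 2 ≤ α * ‖x - y‖ ^ 2 + β * ‖z - y‖ ^ 2 := by
    have h := (convexOn_norm (convex_univ (E := Gains))).pow (fun _ _ => norm_nonneg _) 2
    exact h.2 (Set.mem_univ _) (Set.mem_univ _) ha hb hab
  have h3 := mul_le_mul_of_nonneg_left h2 (show 0 ≤ 2 * max 0 c by positivity)
  have h4 : D.h i n ρ y = α * D.h i n ρ y + β * D.h i n ρ y := by rw [← add_mul, hab, one_mul]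
  rw [h1, map_add, map_smul, map_smul, smul_eq_mul, smul_eq_mul]
  linarith

theorem convex_base : Convex ℝ D.base := by
  rintro z ⟨hz1, hz2⟩ w ⟨hw1, hw2⟩ a c ha hc hac
  exact ⟨D.convex_K hz1 hw1 ha hc hac,
    fun j => add_nonneg (mul_nonneg ha (hz2 j)) (mul_nonneg hc (hw2 j))⟩

variable (cbar : Fin b → Fin Ns → Fin 4 → Fin N → ℝ)

/-- The smoothing is convex and increasing and is applied to a convex function of `(x, u)`; the
remaining term is linear in `u`. -/
theorem constrSur_convex (y : Gains) (j : Idx N b) {z w : Var N b} {α β : ℝ} (ha : 0 ≤ α)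
    (hb : 0 ≤ β) (hab : α + β = 1) :
    D.constrSur cbar y j (α • z + β • w) ≤
      α * D.constrSur cbar y j z + β * D.constrSur cbar y j w := by
  simp only [constrSur]
  rw [mul_left_comm, mul_left_comm β, ← mul_add, Finset.mul_sum _ _ α, Finset.mul_sum _ _ β,
    ← Finset.sum_add_distrib]
  refine mul_le_mul_of_nonneg_left (Finset.sum_le_sum fun s _ => ?_) (by positivity)
  simp only [gSur, Prod.fst_add, Prod.smul_fst, Prod.snd_add, Prod.smul_snd, Pi.add_apply,
    Pi.smul_apply, smul_eq_mul]
  have h1 := D.hSur_convex (cbar j.2.2 s j.1 j.2.1) j.1 j.2.1 (D.ρ j.2.2 s) y (x := z.1) (z := w.1)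
    ha hb hab
  have h2 := D.smoothPos_mono (show _ ≤ _ from (add_le_add_left h1 (α * z.2 j + β * w.2 j)))
  have h3 := D.smoothPos_convex (y := D.hSur (cbar j.2.2 s j.1 j.2.1) j.1 j.2.1 (D.ρ j.2.2 s) y z.1
    + z.2 j) (z := D.hSur (cbar j.2.2 s j.1 j.2.1) j.1 j.2.1 (D.ρ j.2.2 s) y w.1 + w.2 j) ha hb hab
  rw [show ∀ p q r t : ℝ, α * (p + q) + β * (r + t) = α * p + β * r + (α * q + β * t) by
    intros; ring] at h3
  linarith

theorem convex_feasibleSur (y : Gains) : Convex ℝ (D.feasibleSur cbar y) := by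
  rintro z ⟨hz1, hz2⟩ w ⟨hw1, hw2⟩ a c ha hc hac
  refine ⟨D.convex_base hz1 hw1 ha hc hac, fun j =>
    (D.constrSur_convex cbar y j ha hc hac).trans ?_⟩
  nlinarith [hz2 j, hw2 j]

theorem constrSur_self (y : Gains) (j : Idx N b) (u : Idx N b → ℝ) :
    D.constrSur cbar y j (y, u) = D.constr j (y, u) := by
  simp [constrSur, constr, gSur, g, hSur_self]

theorem mem_feasibleSur_self {y : Gains} {u : Idx N b → ℝ} (h : (y, u) ∈ D.feasible) :
    (y, u) ∈ D.feasibleSur cbar y :=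
  ⟨h.1, fun j => (D.constrSur_self cbar y j u).trans_le (h.2 j)⟩

variable {cbar}

/-- The upper bound `h_le_hSur` passes through the increasing smoothing to the averages. -/
theorem feasibleSur_subset (hcbar : D.IsCurvatureBound cbar) {y : Gains} (hy : y ∈ D.K) :
    D.feasibleSur cbar y ⊆ D.feasible := by
  rintro z ⟨hz1, hz2⟩
  refine ⟨hz1, fun j => le_trans ?_ (hz2 j)⟩
  refine mul_le_mul_of_nonneg_left (Finset.sum_le_sum fun s _ => ?_) (by positivity)
  exact sub_le_sub_right (D.smoothPos_mono (add_le_add_left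
    (D.h_le_hSur (hcbar j.2.2 s j.1 j.2.1) hz1.1 hy) _)) _

theorem feasibleGains_subset : D.feasibleGains ⊆ D.K := fun _ ⟨_, hu⟩ => hu.1.1

/-- A step of the algorithm stays feasible. -/
theorem step_mem_feasibleGains (hcbar : D.IsCurvatureBound cbar) {d γ : ℝ} {y xs : Gains}
    (hy : y ∈ D.feasibleGains) (hxs : D.IsSubSolution d cbar y xs) (h0 : 0 ≤ γ) (h1 : γ ≤ 1) :
    y + γ • (xs - y) ∈ D.feasibleGains := by
  obtain ⟨u, hu⟩ := hy
  obtain ⟨us, hus, -⟩ := hxs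
  have h := D.convex_feasibleSur cbar y (D.mem_feasibleSur_self cbar hu) hus
    (sub_nonneg.2 h1) h0 (sub_add_cancel 1 γ)
  refine ⟨(1 - γ) • u + γ • us, D.feasibleSur_subset hcbar hu.1.1 ?_⟩
  convert h using 1
  refine Prod.ext ?_ rfl
  simp only [Prod.fst_add, Prod.smul_fst]
  module

/-- The derivative of a constraint function only depends on values and derivatives of the functions
`H s` of the gains. -/
theorem hasFDerivAt_constr_aux (j : Idx N b) (ε : ℝ) {H : Fin Ns → Gains → ℝ} (z : Var N b)
    {H' : Fin Ns → Gains →L[ℝ] ℝ} (hH : ∀ s, HasFDerivAt (H s) (H' s) z.1) :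
    HasFDerivAt (fun w : Var N b => (1 / (Ns : ℝ)) *
        ∑ s, (D.smoothPos (H s w.1 + w.2 j) - w.2 j * ε))
      ((1 / (Ns : ℝ)) • ∑ s, (deriv D.smoothPos (H s z.1 + z.2 j) •
        (H' s ∘L ContinuousLinearMap.fst ℝ Gains (Idx N b → ℝ) + auxCoord j) -
          ε • auxCoord j)) z := by
  refine (HasFDerivAt.fun_sum fun s _ => ?_).const_mul _
  have h1 : HasFDerivAt (fun w : Var N b => w.2 j) (auxCoord j) z := (auxCoord j).hasFDerivAt
  have h2 : HasFDerivAt (fun w : Var N b => H s w.1)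
      (H' s ∘L ContinuousLinearMap.fst ℝ Gains (Idx N b → ℝ)) z :=
    (hH s).comp z hasFDerivAt_fst
  exact ((D.hasDerivAt_smoothPos _).differentiableAt.hasDerivAt.comp_hasFDerivAt z
    (h2.add h1)).sub (h1.mul_const ε)

/-- The correction added to the linearization is quadratic in `x - y`, so it has zero derivative at
`y`. -/
theorem hasFDerivAt_hSur_self (c : ℝ) (i : Fin 4) (n : Fin N) (ρ : Fin N → ℝ) (y : Gains) :
    HasFDerivAt (D.hSur c i n ρ y) (fderiv ℝ (D.h i n ρ) y) y := by
  have h1 : HasFDerivAt (fun x : Gains => x - y) (.id ℝ _) y := (hasFDerivAt_id y).sub_const y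
  have h2 : HasFDerivAt (fun x : Gains => ‖x - y‖ ^ 2) (0 : Gains →L[ℝ] ℝ) y := by
    refine h1.norm_sq.congr_fderiv ?_
    simp
  unfold hSur
  simp only [dotProduct_surrogateMatrix]
  refine ((((fderiv ℝ (D.h i n ρ) y).hasFDerivAt.comp y h1).const_add _).add
    (h2.const_mul (2 * max 0 c))).congr_fderiv ?_
  ext
  simp

/-- At the base point, the surrogate constraints have the derivatives of the constraints. -/
theorem hasFDerivAt_constrSur_self (j : Idx N b) {z : Var N b} (hz : gainSum z.1 ∈ D.dom) :
    HasFDerivAt (D.constrSur cbar z.1 j) (fderiv ℝ (D.constr j) z) z := by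
  have h1 := D.hasFDerivAt_constr_aux j (D.ε j.1) z fun s : Fin Ns =>
    (D.hasFDerivAt_h j.1 j.2.1 (D.ρ j.2.2 s) hz).differentiableAt.hasFDerivAt
  have h2 := D.hasFDerivAt_constr_aux j (D.ε j.1) z fun s : Fin Ns =>
    D.hasFDerivAt_hSur_self (cbar j.2.2 s j.1 j.2.1) j.1 j.2.1 (D.ρ j.2.2 s) z.1
  have h3 : HasFDerivAt (D.constr j) _ z := h1
  rw [h3.fderiv]
  simp only [hSur_self] at h2
  exact h2

theorem continuousAt_constrSur (j : Idx N b) (w : Var N b) {y : Gains} (hy : gainSum y ∈ D.dom) :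
    ContinuousAt (fun y => D.constrSur cbar y j w) y := by
  refine continuousAt_const.mul (tendsto_finsetSum _ fun s _ => ?_)
  refine ContinuousAt.sub ?_ continuousAt_const
  refine (D.hasDerivAt_smoothPos _).continuousAt.comp (ContinuousAt.add ?_ continuousAt_const)
  refine ContinuousAt.congr ?_ ((D.eventually_mem_dom hy).mono fun z hz =>
    (D.hSur_eq _ _ _ _ hz _).symm)
  have hp : ∀ c p, ContinuousAt (fun z => D.pole c p (gainSum z)) y := fun c p =>
    (D.hasFDerivAt_pole_gainSum c p hy).continuousAt
  have hg : Continuous fun z : Gains => gainSum (w.1 - z) := by fun_prop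
  exact ((continuousAt_const.add (hp _ _)).sub ((hp _ _).mul hg.continuousAt)).add
    (Continuous.continuousAt (by fun_prop))

end

section

variable {N b Ns : ℕ} (D : Data N b Ns)

/-! ### Descent of the objective -/

theorem pole_nonneg {c : Fin N → ℝ} (hc : ∀ k, 0 ≤ c k) (p : ℕ) {s : ℝ} (hs : s ∈ D.dom) :
    0 ≤ D.pole c p s :=
  Finset.sum_nonneg fun k _ => div_nonneg (hc k) (pow_nonneg (hs k).le p)

theorem pole_pos {c : Fin N → ℝ} (hc : ∀ k, 0 ≤ c k) (hc' : ∃ k, c k ≠ 0) (p : ℕ) {s : ℝ}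
    (hs : s ∈ D.dom) : 0 < D.pole c p s := by
  obtain ⟨k, hk⟩ := hc'
  exact Finset.sum_pos' (fun k _ => div_nonneg (hc k) (pow_nonneg (hs k).le p))
    ⟨k, Finset.mem_univ k, div_pos ((hc k).lt_of_ne' hk) (pow_pos (hs k) p)⟩

theorem pole_anti {c : Fin N → ℝ} (hc : ∀ k, 0 ≤ c k) (p : ℕ) {s t : ℝ} (hs : s ∈ D.dom)
    (hst : s ≤ t) : D.pole c p t ≤ D.pole c p s :=
  Finset.sum_le_sum fun k _ => div_le_div_of_nonneg_left (hc k) (pow_pos (hs k) p)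
    (pow_le_pow_left₀ (hs k).le (by linarith) p)

theorem objective_nonneg (x : Gains) : 0 ≤ D.objective x :=
  Finset.sum_nonneg fun _ _ => mul_nonneg (by positivity)
    (Finset.sum_nonneg fun _ _ => sq_nonneg _)

variable {D} {d : ℝ} {cbar : Fin b → Fin Ns → Fin 4 → Fin N → ℝ}

/-- First-order optimality in the subproblem, compared with the base point. -/
theorem IsSubSolution.directional_le {y xs : Gains} (hxs : D.IsSubSolution d cbar y xs)
    (hNs : 0 < Ns) (hy : y ∈ D.feasibleGains) :
    -2 * D.pole D.weight 3 (gainSum y) * gainSum (xs - y) ≤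
      -2 * (D.pole D.weight 4 (gainSum y) * gainSum (xs - y) ^ 2 + b * d / 2 * ‖xs - y‖ ^ 2) := by
  have hdom := D.gainSum_mem_dom (D.feasibleGains_subset hy)
  obtain ⟨u, hu⟩ := hy
  obtain ⟨us, hus, hmin⟩ := hxs
  set A := -2 * D.pole D.weight 3 (gainSum y) * gainSum (xs - y)
  set E := D.pole D.weight 4 (gainSum y) * gainSum (xs - y) ^ 2 + b * d / 2 * ‖xs - y‖ ^ 2
  -- Relative to `y`, the surrogate objective is a linear part `A` plus a quadratic part `E`.
  -- Comparing `xs` with the point a fraction `t` of the way to `y` gives `A + E ≤ (1 - t) A + (1 -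
  -- t)² E`; divide by `t` and let `t → 0`.
  have key : ∀ t : ℝ, 0 < t → t ≤ 1 → A + 2 * E ≤ t * E := fun t ht0 ht1 => by
    have h1 := hmin _ (D.convex_feasibleSur cbar y hus (D.mem_feasibleSur_self cbar hu)
      (sub_nonneg.2 ht1) ht0.le (sub_add_cancel 1 t))
    rw [D.objectiveSur_eq hNs d hdom, D.objectiveSur_eq hNs d hdom] at h1
    have h2 : ((1 - t) • (xs, us) + t • (y, u)).1 - y = (1 - t) • (xs - y) := by
      simp only [Prod.fst_add, Prod.smul_fst]
      module
    rw [h2, map_smul, norm_smul, smul_eq_mul, Real.norm_of_nonneg (sub_nonneg.2 ht1)] at h1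
    have h3 : t * (A + 2 * E) ≤ t * (t * E) := by
      simp only [A, E]
      linarith
    exact le_of_mul_le_mul_left h3 ht0
  have hlim : Tendsto (fun t : ℝ => t * E) (𝓝[>] 0) (𝓝 (0 * E)) :=
    ((continuous_id.mul continuous_const).tendsto 0).mono_left nhdsWithin_le_nhds
  have h1 : A + 2 * E ≤ 0 * E := ge_of_tendsto hlim <| by
    filter_upwards [eventually_mem_nhdsWithin, (ge_mem_nhds one_pos).filter_mono nhdsWithin_le_nhds]
      with t ht0 ht1 using key t ht0 ht1
  linarith

theorem objective_le_quadratic {C : ℝ}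
    (hC : ∀ s ∈ gainSum '' D.K, ∀ t ∈ gainSum '' D.K, s ≤ t →
      -2 * D.pole D.weight 3 t - -2 * D.pole D.weight 3 s ≤ C * (t - s))
    {x y : Gains} (hx : x ∈ D.K) (hy : y ∈ D.K) :
    D.objective x ≤ D.objective y + -2 * D.pole D.weight 3 (gainSum y) * gainSum (x - y) +
      C / 2 * gainSum (x - y) ^ 2 := by
  have h1 : ∀ s ∈ gainSum '' D.K,
      HasDerivAt (D.pole D.weight 2) (-2 * D.pole D.weight 3 s) s := by
    rintro _ ⟨z, hz, rfl⟩
    exact (D.hasDerivAt_pole D.weight 2 (D.gainSum_mem_dom hz)).congr_deriv (by norm_num)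
  have h2 := le_quadratic_of_deriv_sub_le (D.convex_K.linear_image gainSum.toLinearMap) h1 hC
    (Set.mem_image_of_mem _ hy) (Set.mem_image_of_mem _ hx)
  rw [D.objective_eq (D.gainSum_mem_dom hx), D.objective_eq (D.gainSum_mem_dom hy), map_sub]
  exact h2

/-- A quadratic bound of the objective along a step of the algorithm. -/
theorem objective_step_le (hNs : 0 < Ns) (hcbar : D.IsCurvatureBound cbar) {C : ℝ}
    (hC : ∀ s ∈ gainSum '' D.K, ∀ t ∈ gainSum '' D.K, s ≤ t →
      -2 * D.pole D.weight 3 t - -2 * D.pole D.weight 3 s ≤ C * (t - s))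
    {y xs : Gains} (hy : y ∈ D.feasibleGains) (hxs : D.IsSubSolution d cbar y xs) {γ : ℝ}
    (h0 : 0 ≤ γ) (h1 : γ ≤ 1) :
    D.objective (y + γ • (xs - y)) ≤ D.objective y - γ *
      (2 * D.pole D.weight 4 (gainSum y) * gainSum (xs - y) ^ 2 + b * d * ‖xs - y‖ ^ 2 -
        C / 2 * γ * gainSum (xs - y) ^ 2) := by
  have h2 := objective_le_quadratic hC
    (D.feasibleGains_subset (D.step_mem_feasibleGains hcbar hy hxs h0 h1))
    (D.feasibleGains_subset hy)
  have h3 := mul_le_mul_of_nonneg_left (hxs.directional_le hNs hy) h0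
  rw [add_sub_cancel_left, map_smul, smul_eq_mul] at h2
  linarith

/-- The derivative in `s` is `6 * pole 4`, which is decreasing; its value at `s = 0` bounds it on
`𝒦`. -/
theorem exists_pole_deriv_bound :
    ∃ C, 0 ≤ C ∧ ∀ s ∈ gainSum '' D.K, ∀ t ∈ gainSum '' D.K, s ≤ t →
      -2 * D.pole D.weight 3 t - -2 * D.pole D.weight 3 s ≤ C * (t - s) := by
  have h0 := D.mem_dom_of_nonneg le_rfl
  refine ⟨6 * D.pole D.weight 4 0,
    mul_nonneg (by norm_num) (D.pole_nonneg D.weight_nonneg 4 h0),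
    sub_le_of_hasDerivAt_le (f' := fun s => 6 * D.pole D.weight 4 s)
      (D.convex_K.linear_image gainSum.toLinearMap) ?_ ?_⟩
  · rintro _ ⟨z, hz, rfl⟩
    refine ((D.hasDerivAt_pole D.weight 3 (D.gainSum_mem_dom hz)).const_mul (-2)).congr_deriv ?_
    push_cast
    ring
  · rintro _ ⟨z, hz, rfl⟩
    exact mul_le_mul_of_nonneg_left
      (D.pole_anti D.weight_nonneg 4 h0 (D.gainSum_nonneg hz)) (by norm_num)

/-- Sufficient decrease for small steps. -/
theorem exists_descent_of_tendsto_zero (hb : 0 < b) (hNs : 0 < Ns) (hd : 0 < d)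
    (hcbar : D.IsCurvatureBound cbar) {γ : ℕ → ℝ} (hγ : ∀ p, 0 < γ p ∧ γ p ≤ 1)
    (hlim : Tendsto γ atTop (𝓝 0)) :
    ∃ a > 0, ∃ P, ∀ p ≥ P, ∀ y ∈ D.feasibleGains, ∀ xs, D.IsSubSolution d cbar y xs →
      D.objective (y + γ p • (xs - y)) ≤ D.objective y - a * γ p * ‖xs - y‖ ^ 2 := by
  obtain ⟨C, hC0, hC⟩ := exists_pole_deriv_bound (D := D)
  have hbd : (0 : ℝ) < b * d := by positivity
  have hev : ∀ᶠ p in atTop, C * γ p < b * d / 2 := by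
    have := hlim.const_mul C
    rw [mul_zero] at this
    exact this.eventually_lt_const (by linarith)
  obtain ⟨P, hP⟩ := eventually_atTop.1 hev
  refine ⟨b * d / 2, by linarith, P, fun p hp y hy xs hxs => ?_⟩
  have h1 := objective_step_le hNs hcbar hC hy hxs (hγ p).1.le (hγ p).2
  have h2 : 0 ≤ D.pole D.weight 4 (gainSum y) := D.pole_nonneg D.weight_nonneg 4
    (D.gainSum_mem_dom (D.feasibleGains_subset hy))
  have h3 := gainSum_sq_le (xs - y)
  -- Half of the proximal term absorbs the curvature term, because `(v₁ + v₂)² ≤ 2 ‖v‖²` and `C * γ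
  -- p` is at most `b * d / 2`.
  have h4 : b * d / 2 * ‖xs - y‖ ^ 2 ≤ 2 * D.pole D.weight 4 (gainSum y) * gainSum (xs - y) ^ 2 +
      b * d * ‖xs - y‖ ^ 2 - C / 2 * γ p * gainSum (xs - y) ^ 2 := by
    have h5 := mul_nonneg h2 (sq_nonneg (gainSum (xs - y)))
    have h6 := mul_le_mul_of_nonneg_left h3 (mul_nonneg hC0 (hγ p).1.le)
    have h7 := mul_le_mul_of_nonneg_right (hP p hp).le (sq_nonneg ‖xs - y‖)
    linarith
  have h5 := mul_le_mul_of_nonneg_left h4 (hγ p).1.le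
  linarith

/-- A constant of strong convexity of the surrogate objective is at most `d`, the curvature in the
direction `(1, -1)`. -/
theorem strongConvex_const_le {c : ℝ} {ρ : Fin N → ℝ} {y : Gains} (hy : y ∈ D.K)
    (h : StrongConvexOn D.K c (D.h0Sur d ρ y)) : c ≤ d := by
  -- Moving along `(1, -1)` stays in `𝒦` and fixes `x₁ + x₂`, so only the proximal term of the
  -- surrogate varies.
  set e : Gains := !₂[1, -1] with he
  have he0 : gainSum e = 0 := by simp [he]
  have hen : ‖e‖ ^ 2 = 2 := by
    rw [EuclideanSpace.real_norm_sq_eq, Fin.sum_univ_two]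
    norm_num [he]
  have hye : y + e ∈ D.K := by
    obtain ⟨h1, h2, h3, h4⟩ := hy
    refine ⟨fun n => ?_, ?_, ?_, ?_⟩ <;> simp [he]
    · linarith [h1 n]
    · linarith
    · linarith
    · linarith
  obtain ⟨-, hsc⟩ := h
  have h1 := hsc hy hye (a := 1 / 2) (b := 1 / 2) (by norm_num) (by norm_num) (by norm_num)
  have h2 : (1 / 2 : ℝ) • y + (1 / 2 : ℝ) • (y + e) - y = (1 / 2 : ℝ) • e := by module
  have hdom := D.gainSum_mem_dom hy
  simp only [D.h0Sur_eq d ρ hdom, h2, map_smul, add_sub_cancel_left, sub_self, map_zero, norm_zero,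
    he0, hen, norm_smul, mul_pow, sub_add_cancel_left, norm_neg, smul_eq_mul] at h1
  norm_num at h1
  linarith

/-- A Lipschitz constant `L` of the gradient of `h₀` on `𝒦` gives the constant `L / 2` for the
derivative in `x₁ + x₂`. -/
theorem pole_sub_le_of_lipschitz {L : NNReal} {ρ : Fin N → ℝ}
    (hL : LipschitzOnWith L (gradient (D.h0 ρ)) D.K) {s t : ℝ} (hs : s ∈ gainSum '' D.K)
    (ht : t ∈ gainSum '' D.K) (hst : s ≤ t) :
    -2 * D.pole (fun k => D.coef ρ k ^ 2) 3 t - -2 * D.pole (fun k => D.coef ρ k ^ 2) 3 s ≤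
      L / 2 * (t - s) := by
  have hs0 : 0 ≤ s := by
    obtain ⟨z, hz, rfl⟩ := hs
    exact D.gainSum_nonneg hz
  -- Points with coordinate sum `r` on a line of direction `(1, 1)`, parallel to the gradients. The
  -- shift by `t` gives the coordinates the right signs for `0 ≤ r ≤ t`. Projecting on `(1, 1)`, of
  -- squared norm `2`, produces the constant `L / 2`.
  set pt : ℝ → Gains := fun r => !₂[r / 2 + t, r / 2 - t] with hpt
  have hptK : ∀ r ∈ gainSum '' D.K, r ≤ t → pt r ∈ D.K := by
    rintro _ ⟨z, hz, rfl⟩ hr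
    have h0 := D.gainSum_nonneg hz
    have h1 := hz.1
    rw [gainSum_apply] at h0 hr
    refine ⟨fun n => ?_, ?_, ?_, ?_⟩ <;> simp [hpt]
    · linarith [h1 n]
    · linarith
    · linarith
    · linarith
  have hsum : ∀ r, gainSum (pt r) = r := fun r => by
    simp [hpt]
  set v : Gains := !₂[1, 1] with hv
  have hgrad : ∀ r ∈ gainSum '' D.K, inner ℝ (gradient (D.h0 ρ) (pt r)) v =
      2 * (-2 * D.pole (fun k => D.coef ρ k ^ 2) 3 r) := fun r hr => by
    have hdom : gainSum (pt r) ∈ D.dom := by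
      rw [hsum]
      obtain ⟨z, hz, rfl⟩ := hr
      exact D.gainSum_mem_dom hz
    have h1 := (D.hasFDerivAt_pole_gainSum (fun k => D.coef ρ k ^ 2) 2 hdom).congr_of_eventuallyEq
      ((D.eventually_mem_dom hdom).mono fun y hy => D.h0_eq ρ hy)
    rw [inner_gradient_left, h1.fderiv, hsum]
    simp [hv]
    ring
  have h1 : inner ℝ (gradient (D.h0 ρ) (pt t) - gradient (D.h0 ρ) (pt s)) v ≤
      L * ‖pt t - pt s‖ * ‖v‖ := (real_inner_le_norm _ _).trans
    (mul_le_mul_of_nonneg_right (hL.norm_sub_le (hptK t ht le_rfl) (hptK s hs hst))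
      (norm_nonneg _))
  rw [inner_sub_left, hgrad t ht, hgrad s hs] at h1
  have h2 : pt t - pt s = ((t - s) / 2) • v := by
    ext i
    fin_cases i <;> simp [hpt, hv] <;> ring
  have h3 : ‖v‖ ^ 2 = 2 := by
    rw [EuclideanSpace.real_norm_sq_eq, Fin.sum_univ_two]
    norm_num [hv]
  rw [h2, norm_smul, Real.norm_of_nonneg (by linarith)] at h1
  have h4 : (L : ℝ) * ((t - s) / 2 * ‖v‖) * ‖v‖ = L * (t - s) := by
    linear_combination (L * ((t - s) / 2) : ℝ) * h3
  linarith

/-- Sufficient decrease for the first step-size rule. -/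
theorem exists_descent_of_bounded (hb : 0 < b) (hNs : 0 < Ns) (hd : 0 < d)
    (hcbar : D.IsCurvatureBound cbar) {c : ℝ} {L : NNReal} {γmax : ℝ} (hγmax : γmax ≤ 1)
    (hc : ∀ m s, ∀ y ∈ D.feasibleGains, StrongConvexOn D.K c (D.h0Sur d (D.ρ m s) y))
    (hL : ∀ m s, LipschitzOnWith L (gradient (D.h0 (D.ρ m s))) D.K) (hcL : γmax * L ≤ 2 * c) :
    ∃ a > 0, ∀ γ : ℝ, 0 < γ → γ ≤ γmax → ∀ y ∈ D.feasibleGains, ∀ xs,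
      D.IsSubSolution d cbar y xs →
        D.objective (y + γ • (xs - y)) ≤ D.objective y - a * γ * ‖xs - y‖ ^ 2 := by
  have hbd : (0 : ℝ) < b * d := by positivity
  have hC : ∀ s ∈ gainSum '' D.K, ∀ t ∈ gainSum '' D.K, s ≤ t →
      -2 * D.pole D.weight 3 t - -2 * D.pole D.weight 3 s ≤ b * L / 2 * (t - s) := by
    intro s hs t ht hst
    have hN : (Ns : ℝ) ≠ 0 := by positivity
    have h1 : ∑ m, (1 / (Ns : ℝ)) * ∑ j, (-2 * D.pole (fun k => D.coef (D.ρ m j) k ^ 2) 3 t -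
        -2 * D.pole (fun k => D.coef (D.ρ m j) k ^ 2) 3 s) ≤
        ∑ _m : Fin b, (1 / (Ns : ℝ)) * ∑ _j : Fin Ns, L / 2 * (t - s) :=
      Finset.sum_le_sum fun m _ => mul_le_mul_of_nonneg_left
        (Finset.sum_le_sum fun j _ => pole_sub_le_of_lipschitz (hL m j) hs ht hst) (by positivity)
    have h2 : ∑ _m : Fin b, (1 / (Ns : ℝ)) * ∑ _j : Fin Ns, L / 2 * (t - s) =
        b * L / 2 * (t - s) := by
      simp only [Finset.sum_const, Finset.card_univ, Fintype.card_fin, nsmul_eq_mul]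
      field_simp
    have h3 : ∑ m, (1 / (Ns : ℝ)) * ∑ j, (-2 * D.pole (fun k => D.coef (D.ρ m j) k ^ 2) 3 t -
        -2 * D.pole (fun k => D.coef (D.ρ m j) k ^ 2) 3 s) =
        -2 * D.pole D.weight 3 t - -2 * D.pole D.weight 3 s := by
      rw [← sum_pole_coef, ← sum_pole_coef]
      simp only [Finset.sum_sub_distrib, mul_sub, ← Finset.mul_sum]
      simp only [mul_left_comm (1 / (Ns : ℝ))]
    linarith
  by_cases hw : ∃ k, D.weight k ≠ 0
  · have h2dom : (2 : ℝ) ∈ D.dom := D.mem_dom_of_nonneg (by norm_num)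
    have hpos := D.pole_pos D.weight_nonneg hw 4 h2dom
    -- Split `δ` into its components along `(1, 1)` and `(1, -1)`. Along `(1, 1)` the curvature loss
    -- may cancel the whole proximal gain, as only `γ L ≤ 2 c ≤ 2 d` is known; the term `2 * pole 4`
    -- remains, and it is smallest at `s = 2`. Along `(1, -1)` the gain `b d` is intact.
    refine ⟨min (4 * D.pole D.weight 4 2) (b * d), by positivity,
      fun γ hγ0 hγ1 y hy xs hxs => ?_⟩
    have hyK := D.feasibleGains_subset hy
    have h1 := objective_step_le hNs hcbar hC hy hxs hγ0.le (hγ1.trans hγmax)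
    obtain ⟨k, -⟩ := hw
    have h2 := D.pole_anti D.weight_nonneg 4 (D.gainSum_mem_dom hyK) (D.gainSum_le_two hyK k)
    have hcd : c ≤ d := strongConvex_const_le hyK (hc ⟨0, hb⟩ ⟨0, hNs⟩ y hy)
    have hγL : γ * L ≤ 2 * d :=
      (mul_le_mul_of_nonneg_right hγ1 L.coe_nonneg).trans (by linarith)
    set δ := xs - y
    have hn : ‖δ‖ ^ 2 = (gainSum δ ^ 2 + (δ 0 - δ 1) ^ 2) / 2 := by
      rw [EuclideanSpace.real_norm_sq_eq, Fin.sum_univ_two, gainSum_apply]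
      ring
    set a := min (4 * D.pole D.weight 4 2) (b * d)
    have ha1 : a ≤ 4 * D.pole D.weight 4 2 := min_le_left _ _
    have ha2 : a ≤ b * d := min_le_right _ _
    have key : a * ‖δ‖ ^ 2 ≤ 2 * D.pole D.weight 4 (gainSum y) * gainSum δ ^ 2 +
        b * d * ‖δ‖ ^ 2 - b * L / 2 / 2 * γ * gainSum δ ^ 2 := by
      have h3 := mul_le_mul_of_nonneg_right hγL (show 0 ≤ b * gainSum δ ^ 2 by positivity)
      have h4 := mul_le_mul_of_nonneg_right (show a / 2 ≤ 2 * D.pole D.weight 4 (gainSum y) by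
        linarith) (sq_nonneg (gainSum δ))
      have h5 := mul_le_mul_of_nonneg_right ha2 (sq_nonneg (δ 0 - δ 1))
      rw [hn]
      linarith
    have := mul_le_mul_of_nonneg_left key hγ0.le
    linarith
  · push Not at hw
    -- With zero weights only the proximal term is left, so the subproblem returns its base point.
    have hz : ∀ p s, D.pole D.weight p s = 0 := fun p s => by simp [pole, hw]
    refine ⟨1, one_pos, fun γ hγ0 hγ1 y hy xs hxs => ?_⟩
    have h1 := hxs.directional_le hNs hy
    simp only [hz] at h1
    have h2 : ‖xs - y‖ ^ 2 = 0 := le_antisymm (by nlinarith) (sq_nonneg _)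
    have h3 : xs - y = 0 := by simpa using h2
    simp [h3]

variable {γ : ℕ → ℝ}

theorem stepRule_mem_Ioc (hγ : D.StepRuleBounded d γ ∨ D.StepRuleDiminishing d cbar γ) (p : ℕ) :
    0 < γ p ∧ γ p ≤ 1 := by
  rcases hγ with ⟨γmin, γmax, c, L, h1, h2, h3, -⟩ | h
  · exact ⟨h1.trans_le (h2 p).1, (h2 p).2.trans h3⟩
  · exact h.1 p

theorem stepRule_tendsto_sum (hγ : D.StepRuleBounded d γ ∨ D.StepRuleDiminishing d cbar γ) :
    Tendsto (fun P => ∑ p ∈ Finset.range P, γ p) atTop atTop := by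
  rcases hγ with ⟨γmin, γmax, c, L, h1, h2, -⟩ | h
  · refine tendsto_atTop_mono (fun P => ?_) (tendsto_natCast_atTop_atTop.atTop_mul_const h1)
    have := Finset.card_nsmul_le_sum (Finset.range P) γ γmin fun p _ => (h2 p).1
    rwa [Finset.card_range, nsmul_eq_mul] at this
  · exact h.2.2.1

theorem stepRule_descent (hb : 0 < b) (hNs : 0 < Ns) (hd : 0 < d) (hcbar : D.IsCurvatureBound cbar)
    (hγ : D.StepRuleBounded d γ ∨ D.StepRuleDiminishing d cbar γ) :
    ∃ a > 0, ∃ P, ∀ p ≥ P, ∀ y ∈ D.feasibleGains, ∀ xs, D.IsSubSolution d cbar y xs →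
      D.objective (y + γ p • (xs - y)) ≤ D.objective y - a * γ p * ‖xs - y‖ ^ 2 := by
  rcases hγ with ⟨γmin, γmax, c, L, h1, h2, h3, -, hc, hL, hcL⟩ | h
  · obtain ⟨a, ha, h⟩ := exists_descent_of_bounded hb hNs hd hcbar h3 hc hL hcL
    exact ⟨a, ha, 0, fun p _ => h (γ p) (h1.trans_le (h2 p).1) (h2 p).2⟩
  · exact exists_descent_of_tendsto_zero hb hNs hd hcbar h.1 h.2.1

end

section

variable {N b Ns : ℕ} {D : Data N b Ns} {d : ℝ} {cbar : Fin b → Fin Ns → Fin 4 → Fin N → ℝ}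
  {γ : ℕ → ℝ}

/-! ### Limit points -/

/-- A linearized descent direction yields a strictly feasible point of the subproblem that improves
the objective. -/
theorem exists_improving_point (hNs : 0 < Ns) {z z' : Var N b} (hz : z ∈ D.feasible)
    (hz' : z' ∈ D.base) (hU : fderiv ℝ (fun w : Var N b => D.objective w.1) z (z' - z) < 0)
    (hG : ∀ j, D.constr j z + fderiv ℝ (D.constr j) z (z' - z) < 0) :
    ∃ w ∈ D.base, (∀ j, D.constrSur cbar z.1 j w < 0) ∧
      D.objectiveSur d z.1 w.1 < D.objective z.1 := by
  have hdom := D.gainSum_mem_dom hz.1.1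
  have hline : HasDerivAt (fun t : ℝ => z + t • (z' - z)) (z' - z) 0 := by
    simpa using ((hasDerivAt_id (0 : ℝ)).smul_const (z' - z)).const_add z
  have h1 : ∀ j, ∀ᶠ t in 𝓝[>] (0 : ℝ), D.constrSur cbar z.1 j (z + t • (z' - z)) < 0 := fun j => by
    have h0 : D.constrSur cbar z.1 j (z + (0 : ℝ) • (z' - z)) = D.constr j z := by
      rw [zero_smul, add_zero]
      exact D.constrSur_self cbar z.1 j z.2
    have hd : HasFDerivAt (D.constrSur cbar z.1 j) (fderiv ℝ (D.constr j) z)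
        (z + (0 : ℝ) • (z' - z)) := by
      simpa using D.hasFDerivAt_constrSur_self (cbar := cbar) j hdom
    have hd' : HasDerivAt (fun t : ℝ => D.constrSur cbar z.1 j (z + t • (z' - z)))
        (fderiv ℝ (D.constr j) z (z' - z)) 0 := by
      have := HasFDerivAt.comp_hasDerivAt (f := fun t : ℝ => z + t • (z' - z)) (0 : ℝ) hd hline
      exact this
    refine eventually_neg_of_hasDerivAt hd' (h0.trans_le (hz.2 j)) ?_
    rw [h0]
    exact hG j
  have h2 : ∀ᶠ t in 𝓝[>] (0 : ℝ),
      D.objectiveSur d z.1 (z.1 + t • (z'.1 - z.1)) - D.objective z.1 < 0 := by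
    have hU' : HasFDerivAt (fun w : Var N b => D.objective w.1) _ z :=
      (D.hasFDerivAt_objective hdom).comp z hasFDerivAt_fst
    rw [hU'.fderiv] at hU
    have hf : (fun t : ℝ => D.objectiveSur d z.1 (z.1 + t • (z'.1 - z.1)) - D.objective z.1) =
        fun t => t * (-2 * D.pole D.weight 3 (gainSum z.1) * gainSum (z'.1 - z.1)) + t ^ 2 *
          (D.pole D.weight 4 (gainSum z.1) * gainSum (z'.1 - z.1) ^ 2 +
            b * d / 2 * ‖z'.1 - z.1‖ ^ 2) := by
      funext t
      rw [D.objectiveSur_eq hNs d hdom, D.objective_eq hdom, add_sub_cancel_left, map_smul,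
        norm_smul, mul_pow, smul_eq_mul, Real.norm_eq_abs, sq_abs]
      ring
    have hself : D.objectiveSur d z.1 z.1 = D.objective z.1 := by
      simp [D.objectiveSur_eq hNs d hdom, D.objective_eq hdom]
    have hquad : ∀ A E : ℝ, HasDerivAt (fun t : ℝ => t * A + t ^ 2 * E) A 0 := fun A E => by
      simpa using ((hasDerivAt_id (0 : ℝ)).mul_const A).fun_add
        ((hasDerivAt_pow 2 (0 : ℝ)).mul_const E)
    refine eventually_neg_of_hasDerivAt (hf ▸ hquad _ _) ?_ ?_
    · simp [hself]
    · simpa [hself] using hU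
  have h3 : ∀ᶠ t in 𝓝[>] (0 : ℝ), t ≤ 1 :=
    (ge_mem_nhds one_pos).filter_mono nhdsWithin_le_nhds
  obtain ⟨t, ht1, ht2, ht3, ht0⟩ :=
    ((eventually_all.2 h1).and (h2.and (h3.and eventually_mem_nhdsWithin))).exists
  exact ⟨z + t • (z' - z), D.convex_base.add_smul_sub_mem hz.1 hz' ⟨le_of_lt ht0, ht3⟩, ht1,
    sub_neg.1 ht2⟩

/-- Near a point whose subproblem has a strictly feasible improving point, the solutions of the
subproblems stay away from their base points. -/
theorem exists_lower_bound_direction (hNs : 0 < Ns) (hd : 0 < d) {x : Gains} (hx : x ∈ D.K)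
    {w : Var N b} (hw : w ∈ D.base) (hw1 : ∀ j, D.constrSur cbar x j w < 0)
    (hw2 : D.objectiveSur d x w.1 < D.objective x) :
    ∃ r > 0, ∃ κ > 0, ∀ y ∈ D.K, ‖y - x‖ < r → ∀ xs, D.IsSubSolution d cbar y xs →
      κ ≤ ‖xs - y‖ := by
  have hdom := D.gainSum_mem_dom hx
  have hp : ∀ c p, ContinuousAt (fun z => D.pole c p (gainSum z)) x := fun c p =>
    (D.hasFDerivAt_pole_gainSum c p hdom).continuousAt
  have hg : Continuous fun z : Gains => gainSum (w.1 - z) := by fun_prop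
  have hcont : ContinuousAt (fun y => D.objective y - D.objectiveSur d y w.1) x := by
    refine (D.hasFDerivAt_objective hdom).continuousAt.sub (ContinuousAt.congr ?_
      ((D.eventually_mem_dom hdom).mono fun z hz => (D.objectiveSur_eq hNs d hz w.1).symm))
    exact (((hp _ _).sub ((continuousAt_const.mul (hp _ _)).mul hg.continuousAt)).add
      ((hp _ _).mul (hg.pow 2).continuousAt)).add (Continuous.continuousAt (by fun_prop))
  set η := (D.objective x - D.objectiveSur d x w.1) / 2
  have hη : 0 < η := by simp only [η]; linarith
  set M := D.pole D.weight 3 (gainSum x) + 1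
  have hM : 0 < M := by
    have := D.pole_nonneg D.weight_nonneg 3 hdom
    positivity
  have hev : ∀ᶠ y in 𝓝 x, (∀ j, D.constrSur cbar y j w < 0) ∧
      η < D.objective y - D.objectiveSur d y w.1 ∧ D.pole D.weight 3 (gainSum y) < M :=
    (eventually_all.2 fun j => (D.continuousAt_constrSur j w hdom).eventually_lt_const (hw1 j)).and
      ((hcont.eventually_const_lt (by simp only [η]; linarith)).and
        ((hp D.weight 3).eventually_lt_const (by simp only [M]; linarith)))
  obtain ⟨r, hr, hball⟩ := Metric.eventually_nhds_iff.1 hev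
  -- Near `x` the subproblem at `y` improves on `U(y)` by more than `η`, while a displacement `δ`
  -- can lower the surrogate by at most `2 M (δ₁ + δ₂) ≤ 4 M ‖δ‖`.
  refine ⟨r, hr, η / (4 * M), by positivity, fun y hy hyr xs ⟨us, _, hmin⟩ => ?_⟩
  obtain ⟨h1, h2, h3⟩ := hball (by rwa [dist_eq_norm])
  have h4 := hmin w ⟨hw, fun j => (h1 j).le⟩
  have hydom := D.gainSum_mem_dom hy
  rw [D.objective_eq hydom] at h2
  rw [D.objectiveSur_eq hNs d hydom xs] at h4
  have h5 : gainSum (xs - y) ≤ 2 * ‖xs - y‖ := by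
    refine le_of_sq_le_sq ?_ (by positivity)
    have := gainSum_sq_le (xs - y)
    nlinarith [sq_nonneg ‖xs - y‖]
  have h6 : 0 ≤ D.pole D.weight 3 (gainSum y) := D.pole_nonneg D.weight_nonneg 3 hydom
  have h7 : 0 ≤ D.pole D.weight 4 (gainSum y) * gainSum (xs - y) ^ 2 +
      b * d / 2 * ‖xs - y‖ ^ 2 :=
    add_nonneg (mul_nonneg (D.pole_nonneg D.weight_nonneg 4 hydom) (sq_nonneg _)) (by positivity)
  have h8 := mul_le_mul_of_nonneg_left h5 h6
  have h9 := mul_le_mul_of_nonneg_right h3.le (norm_nonneg (xs - y))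
  rw [div_le_iff₀ (by positivity)]
  linarith

/-- A regular point without a linearized descent direction is stationary. -/
theorem IsRegular.isStationary {z : Var N b} (hz : D.IsRegular z)
    (h : ¬ ∃ z' ∈ D.base, fderiv ℝ (fun w : Var N b => D.objective w.1) z (z' - z) < 0 ∧
      ∀ j, D.constr j z + fderiv ℝ (D.constr j) z (z' - z) < 0) : D.IsStationary z := by
  obtain ⟨hfeas, hmf⟩ := hz
  have haff : ∀ (a : ℝ) (ℓ : Var N b →L[ℝ] ℝ), ConvexOn ℝ D.base fun y => a + ℓ (y - z) :=
    fun a ℓ => ⟨D.convex_base, fun y _ w _ α β _ _ hαβ => by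
      obtain rfl : β = 1 - α := by linarith
      simp only [map_sub, map_add, map_smul, smul_eq_mul]
      linarith⟩
  let T : Option (Idx N b) → Var N b → ℝ := fun i y => match i with
    | none => 0 + fderiv ℝ (fun w : Var N b => D.objective w.1) z (y - z)
    | some j => D.constr j z + fderiv ℝ (D.constr j) z (y - z)
  obtain ⟨μ, hμ0, hμ, hcomb⟩ := exists_nonneg_combination (T := T) ⟨z, hfeas.1⟩
    (by rintro (_ | j) <;> exact haff _ _) D.convex_base (fun y hy => by
      by_contra! hneg
      exact h ⟨y, hy, by simpa [T] using hneg none, fun j => hneg (some j)⟩)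
  simp only [Fintype.sum_option, T, zero_add] at hcomb
  have hnonpos : ∀ j, μ (some j) * D.constr j z ≤ 0 := fun j =>
    mul_nonpos_of_nonneg_of_nonpos (hμ0 _) (hfeas.2 j)
  -- Evaluating the combination at `z` itself gives a nonnegative sum of nonpositive terms:
  -- complementary slackness.
  have hsupp : ∀ j, μ (some j) * D.constr j z = 0 := by
    have h1 := hcomb z hfeas.1
    simp only [sub_self, map_zero, mul_zero, add_zero, zero_add] at h1
    have h2 := (Finset.sum_eq_zero_iff_of_nonpos fun j _ => hnonpos j).1
      (le_antisymm (Finset.sum_nonpos fun j _ => hnonpos j) h1)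
    exact fun j => h2 j (Finset.mem_univ j)
  have hsupp' : ∀ j, D.constr j z ≠ 0 → μ (some j) = 0 := fun j hj =>
    (mul_eq_zero.1 (hsupp j)).resolve_right hj
  have hcomb' : ∀ y ∈ D.base,
      0 ≤ μ none * fderiv ℝ (fun w : Var N b => D.objective w.1) z (y - z) +
        ∑ j, μ (some j) * fderiv ℝ (D.constr j) z (y - z) := fun y hy => by
    simpa only [mul_add, hsupp, zero_add] using hcomb y hy
  -- If the multiplier of the objective vanished, regularity would make all the others vanish too,
  -- contradicting nontriviality; dividing by it normalizes the multipliers.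
  have hpos : 0 < μ none := by
    refine (hμ0 none).lt_of_ne' fun h0 => hμ ?_
    have := hmf (fun j => μ (some j)) (fun j => hμ0 _) hsupp' fun y hy => by
      have := hcomb' y hy
      rw [h0, zero_mul, zero_add] at this
      simpa using this
    funext i
    rcases i with _ | j
    · exact h0
    · exact this j
  refine ⟨hfeas, fun j => μ (some j) / μ none, fun j => div_nonneg (hμ0 _) hpos.le,
    fun j hj => div_eq_zero_iff.2 (Or.inl (hsupp' j hj)), fun y hy => ?_⟩
  have h1 := div_nonneg (hcomb' y hy) hpos.le
  rw [add_div, mul_div_cancel_left₀ _ hpos.ne', Finset.sum_div] at h1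
  simp only [mul_div_right_comm] at h1
  simp only [_root_.neg_apply, _root_.add_apply, _root_.sum_apply,
    _root_.smul_apply, smul_eq_mul]
  linarith

theorem iterates_mem_feasibleGains (hcbar : D.IsCurvatureBound cbar) {x : ℕ → Gains}
    (hx : D.IsSCASequence d cbar γ x) (hγ : ∀ p, 0 < γ p ∧ γ p ≤ 1) (p : ℕ) :
    x p ∈ D.feasibleGains := by
  induction p with
  | zero => exact hx.1
  | succ p ih =>
    obtain ⟨xs, hxs, hstep⟩ := hx.2 p
    rw [hstep]
    exact D.step_mem_feasibleGains hcbar ih hxs (hγ p).1.le (hγ p).2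

theorem exists_weight_ne_zero (hNs : 0 < Ns) (h : ∃ m s n, D.ρ m s n ≠ 1) :
    ∃ k, D.weight k ≠ 0 := by
  obtain ⟨m, s, n, hn⟩ := h
  by_contra! hw
  have hcoef : ∀ k, D.coef (D.ρ m s) k = 0 := fun k => by
    have h1 := hw k
    rw [weight, Finset.sum_eq_zero_iff_of_nonneg fun _ _ => mul_nonneg (by positivity)
      (Finset.sum_nonneg fun _ _ => sq_nonneg _)] at h1
    have h2 := (mul_eq_zero.1 (h1 m (Finset.mem_univ m))).resolve_left (by positivity)
    rw [Finset.sum_eq_zero_iff_of_nonneg fun _ _ => sq_nonneg _] at h2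
    exact pow_eq_zero_iff two_ne_zero |>.1 (h2 s (Finset.mem_univ s))
  have h3 := congrFun (D.modal_coef (D.ρ m s)) n
  rw [modal_apply] at h3
  simp only [hcoef, zero_mul, Finset.sum_const_zero] at h3
  exact hn (by linarith)

end

end Data

end GainDesign

end

/-! ### Proof of the proposition -/

theorem mainTheorem1 {N b Ns : ℕ} (hb : 0 < b) (hNs : 0 < Ns) (D : GainDesign.Data N b Ns)
    (d : ℝ) (hd : 0 < d) (cbar : Fin b → Fin Ns → Fin 4 → Fin N → ℝ)
    (hcbar : D.IsCurvatureBound cbar) (γ : ℕ → ℝ) (x : ℕ → GainDesign.Gains)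
    (hx : D.IsSCASequence d cbar γ x)
    (hγ : D.StepRuleBounded d γ ∨ D.StepRuleDiminishing d cbar γ)
    (xbar : GainDesign.Gains) (hlim : MapClusterPt xbar atTop x)
    (u : GainDesign.Idx N b → ℝ) (hreg : D.IsRegular (xbar, u)) :
    D.IsStationary (xbar, u) ∧
      ((∀ p, x (p + 1) ≠ x p) → ¬ IsLocalMaxOn D.objective D.feasibleGains xbar) ∧
      ((∃ m s n, D.ρ m s n ≠ 1) → ¬ IsLocalMax D.objective xbar) := by
  have hγ01 := GainDesign.Data.stepRule_mem_Ioc hγ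
  have hmem := GainDesign.Data.iterates_mem_feasibleGains hcbar hx hγ01
  have hK : xbar ∈ D.K := hreg.1.1.1
  have hdom := D.gainSum_mem_dom hK
  obtain ⟨a, ha, P, hdesc⟩ := GainDesign.Data.stepRule_descent hb hNs hd hcbar hγ
  choose xs hxs hstep using hx.2
  have hdec : ∀ p ≥ P, D.objective (x (p + 1)) ≤
      D.objective (x p) - a * γ p * ‖xs p - x p‖ ^ 2 := fun p hp => by
    rw [hstep]
    exact hdesc p hp _ (hmem p) _ (hxs p)
  refine ⟨hreg.isStationary ?_, fun hne hmax => ?_, fun hρ hmax => ?_⟩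
  · rintro ⟨z', hz', hU, hG⟩
    obtain ⟨w, hw, hw1, hw2⟩ := GainDesign.Data.exists_improving_point (d := d) (cbar := cbar)
      hNs hreg.1 hz' hU hG
    obtain ⟨r, hr, κ, hκ, hlow⟩ :=
      GainDesign.Data.exists_lower_bound_direction hNs hd hK hw hw1 hw2
    exact GainDesign.not_bounded_below_near_clusterPt ha hr hκ (fun p => (hγ01 p).1.le)
      (GainDesign.Data.stepRule_tendsto_sum hγ) hstep (fun p => D.objective_nonneg (x p)) hdec
      hlim fun p hp => hlow (x p) (D.feasibleGains_subset (hmem p)) hp _ (hxs p)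
  · have hlt : ∀ p ≥ P, D.objective (x (p + 1)) < D.objective (x p) := fun p hp => by
      have hδ : 0 < ‖xs p - x p‖ := norm_pos_iff.2 fun h0 => hne p (by rw [hstep, h0]; simp)
      have := hdec p hp
      have : 0 < a * γ p * ‖xs p - x p‖ ^ 2 :=
        mul_pos (mul_pos ha (hγ01 p).1) (pow_pos hδ 2)
      linarith
    -- At a late iterate near a local maximum, `U(x_p) ≤ U(xbar) ≤ U(x_{p+1}) < U(x_p)`; the middle
    -- bound holds because `U(xbar)` lies below the decreasing values.
    obtain ⟨p, hp1, hp2⟩ := ((hlim.frequently (eventually_nhdsWithin_iff.1 hmax)).and_eventually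
      (eventually_ge_atTop P)).exists
    have h1 := hp1 (hmem p)
    have h2 := GainDesign.le_of_mapClusterPt (D.hasFDerivAt_objective hdom).continuousAt hlim
      (fun p hp => (hlt p hp).le) (show P ≤ p + 1 by omega)
    linarith [hlt p hp2]
  -- The gradient is `-2 * pole 3` times `(1, 1)`, and `pole 3` is positive once some weight is
  -- nonzero.
  · have h0 := hmax.hasFDerivAt_eq_zero (D.hasFDerivAt_objective hdom)
    have hpos := D.pole_pos D.weight_nonneg
      (GainDesign.Data.exists_weight_ne_zero hNs hρ) 3 hdom
    have h1 := congrArg (fun ℓ : GainDesign.Gains →L[ℝ] ℝ => ℓ !₂[1, 0]) h0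
    simp at h1
    exact hpos.ne' (by simpa using h1)
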